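/- Let $n \ge 2$ be an integer, $2-n<a<1$, and $\frac{2(n-1)}{n+a-2} \le p < \infty$. Write $\mathbb R^n_+ = \mathbb R^{n-1}\times(0,\infty)$, $x=(x',x_n)$, and let $$P_a(y',x) = c_{n,a}\,\frac{x_n^{1-a}}{(|x'-y'|^2+x_n^2)^{\frac{n-a}{2}}}\qquad (y'\in\mathbb R^{n-1},\ x\in\mathbb R^n_+),$$ where $c_{n,a}>0$ is the constant for which $\int_{\mathbb R^{n-1}}P_a(y',x)\,dy'=1$ for every $x \in \mathbb R^n_+$. For a measurable function $u\ge 0$ on $\mathbb R^{n-1}$ put $(\mathcal P_a u)(x)=\int_{\mathbb R^{n-1}}P_a(y',x)u(y')\,dy' \in [0,\infty]$. Let $K\in C^1(\mathbb R^{n-1})$ be positive everywhere. Suppose that $u\in L^p_{\mathrm{loc}}(\mathbb R^{n-1})$ is non-negative a.e., is not a.e. equal to zero, and satisfies $$K(y')\,u(y')^{p-1}=\int_{\mathbb R^n_+}P_a(y',x)\,\big[(\mathcal P_a u)(x)\big]^{\frac{n-a+2}{n+a-2}}\,dx$$ for almost every $y'\in\mathbb R^{n-1}$ (the right side being an integral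 with values in $[0,\infty]$). Then $u\in C^\beta_{\mathrm{loc}}(\mathbb R^{n-1})$ for every $\beta\in(0,1)$. That is, there is a function $v$ on $\mathbb R^{n-1}$, equal to $u$ almost everywhere, which for every $\beta\in(0,1)$ is $\beta$-Hölder continuous on every compact set; moreover $v(y')=u(y')$ at every point $y'$ where $u(y')\ge 0$ and the equation holds. In particular, if $u \ge 0$ and the equation holds everywhere, then $u$ itself has this regularity. -/

import Mathlib

open MeasureTheory Filter
open scoped ENNReal NNReal

namespace PoissonType

/-- The boundary space `ℝ^{n-1}` with its Euclidean norm. -/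
abbrev Bdry (n : ℕ) : Type := EuclideanSpace ℝ (Fin (n - 1))

/-- The open upper half-space `ℝ^n_+ = ℝ^{n-1} × (0, ∞)`; a point of `ℝ^n` is written as a pair
`x = (x', x_n)`, and `volume` on the product is the `n`-dimensional Lebesgue measure. -/
def halfSpace (n : ℕ) : Set (Bdry n × ℝ) := {x | 0 < x.2}

/-- The kernel without its constant: `x_n^{1-a} / (|x' - y'|^2 + x_n^2)^{(n-a)/2}`. -/
noncomputable def rawKernel (n : ℕ) (a : ℝ) (y : Bdry n) (x : Bdry n × ℝ) : ℝ :=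
  x.2 ^ (1 - a) / (‖x.1 - y‖ ^ 2 + x.2 ^ 2) ^ (((n : ℝ) - a) / 2)

/-- The normalization constant `c_{n,a}`, computed at the point `x = (0, 1)`. That it normalizes
the kernel at every point of the half-space is `integral_kernel` below. -/
noncomputable def normConst (n : ℕ) (a : ℝ) : ℝ :=
  (∫ y : Bdry n, rawKernel n a y (0, 1))⁻¹

/-- The Poisson-type kernel `P_a(y', x)`. -/
noncomputable def kernel (n : ℕ) (a : ℝ) (y : Bdry n) (x : Bdry n × ℝ) : ℝ :=
  normConst n a * rawKernel n a y x

/-- The Poisson-type integral `(𝒫_a u)(x) = ∫ P_a(y', x) u(y') dy'` of a non-negative function `u`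
on `ℝ^{n-1}`, with values in `[0, ∞]`. -/
noncomputable def poissonIntegral (n : ℕ) (a : ℝ) (u : Bdry n → ℝ) (x : Bdry n × ℝ) : ℝ≥0∞ :=
  ∫⁻ y : Bdry n, ENNReal.ofReal (kernel n a y x) * ENNReal.ofReal (u y)

/-- `∫_{ℝ^n_+} P_a(y', x) [(𝒫_a u)(x)]^{(n-a+2)/(n+a-2)} dx`, with values in `[0, ∞]`. -/
noncomputable def nonlinearTerm (n : ℕ) (a : ℝ) (u : Bdry n → ℝ) (y : Bdry n) : ℝ≥0∞ :=
  ∫⁻ x in halfSpace n, ENNReal.ofReal (kernel n a y x) *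
    poissonIntegral n a u x ^ (((n : ℝ) - a + 2) / ((n : ℝ) + a - 2))

/-- The equation `K u^{p-1} = ∫_{ℝ^n_+} P_a(·, x) [(𝒫_a u)(x)]^{(n-a+2)/(n+a-2)} dx` at the
point `y`, for a non-negative `u`, as an equality in `[0, ∞]` with a finite left side. -/
def EquationAt (n : ℕ) (a p : ℝ) (K u : Bdry n → ℝ) (y : Bdry n) : Prop :=
  ENNReal.ofReal (K y * u y ^ (p - 1)) = nonlinearTerm n a u y

/-- `u ∈ L^p_loc(ℝ^{n-1})`: measurable, and `p`-integrable on every compact set. -/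
def MemLpLoc (n : ℕ) (p : ℝ) (u : Bdry n → ℝ) : Prop :=
  AEStronglyMeasurable u volume ∧
    ∀ s : Set (Bdry n), IsCompact s → MemLp u (ENNReal.ofReal p) (volume.restrict s)

/-- `v ∈ C^β_loc(ℝ^{n-1})`: `v` is `β`-Hölder on every compact set. -/
def LocallyHolder (n : ℕ) (β : ℝ≥0) (v : Bdry n → ℝ) : Prop :=
  ∀ s : Set (Bdry n), IsCompact s → ∃ C : ℝ≥0, HolderOnWith C β v s

theorem integrable_rawKernel_one (n : ℕ) (hn : 1 ≤ n) (a : ℝ) (ha : a < 1) :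
    Integrable (fun y : Bdry n => rawKernel n a y (0, 1)) := by
  have h := integrable_rpow_neg_one_add_norm_sq (E := Bdry n) (μ := volume) (r := (n : ℝ) - a)
    (by simp [Nat.cast_sub hn]; linarith)
  refine h.congr (Eventually.of_forall fun y => ?_)
  simp only [rawKernel, zero_sub, norm_neg, Real.one_rpow, one_pow, one_div]
  rw [← Real.rpow_neg (by positivity), add_comm, neg_div]

theorem normConst_pos (n : ℕ) (hn : 1 ≤ n) (a : ℝ) (ha : a < 1) : 0 < normConst n a := by
  refine inv_pos.2 ?_
  have hpos : ∀ y : Bdry n, 0 < rawKernel n a y (0, 1) := fun y => by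
    unfold rawKernel; positivity
  rw [integral_pos_iff_support_of_nonneg (fun y => (hpos y).le) (integrable_rawKernel_one n hn a ha)]
  have : Function.support (fun y : Bdry n => rawKernel n a y (0, 1)) = Set.univ :=
    Set.eq_univ_of_forall fun y => (hpos y).ne'
  rw [this]
  exact Measure.measure_univ_pos.2 (NeZero.ne _)

/-- `∫ P_a(y', x) dy' = 1` for every `x` in the half-space. -/
theorem integral_kernel (n : ℕ) (hn : 1 ≤ n) (a : ℝ) (ha : a < 1) (x : Bdry n × ℝ)
    (hx : x ∈ halfSpace n) : ∫ y : Bdry n, kernel n a y x = 1 := by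
  obtain ⟨x', t⟩ := x
  have ht : 0 < t := hx
  have key : ∫ y : Bdry n, rawKernel n a y (x', t) = ∫ y : Bdry n, rawKernel n a y (0, 1) := by
    have h1 := integral_sub_left_eq_self (μ := (volume : Measure (Bdry n)))
      (fun z : Bdry n => t ^ (1 - a) / (‖z‖ ^ 2 + t ^ 2) ^ (((n : ℝ) - a) / 2)) x'
    have h2 := Measure.integral_comp_smul (volume : Measure (Bdry n))
      (fun z : Bdry n => t ^ (1 - a) / (‖z‖ ^ 2 + t ^ 2) ^ (((n : ℝ) - a) / 2)) t
    have h3 : ∀ z : Bdry n, t ^ (1 - a) / (‖t • z‖ ^ 2 + t ^ 2) ^ (((n : ℝ) - a) / 2)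
        = (t ^ (n - 1))⁻¹ * rawKernel n a z (0, 1) := by
      intro z
      have e : ‖t • z‖ ^ 2 + t ^ 2 = t ^ 2 * (‖z‖ ^ 2 + 1) := by
        rw [norm_smul, Real.norm_of_nonneg ht.le]; ring
      have e2 : (t ^ 2) ^ (((n : ℝ) - a) / 2) = t ^ (1 - a) * t ^ (n - 1) := by
        rw [← Real.rpow_natCast t 2, ← Real.rpow_mul ht.le, ← Real.rpow_natCast t (n - 1),
          ← Real.rpow_add ht, Nat.cast_sub hn]
        congr 1; push_cast; ring
      rw [e, Real.mul_rpow (by positivity) (by positivity), e2]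
      simp only [rawKernel, zero_sub, norm_neg, Real.one_rpow, one_pow]
      have := (Real.rpow_pos_of_pos ht (1 - a)).ne'
      field_simp
    simp_rw [h3] at h2
    rw [integral_const_mul, finrank_euclideanSpace_fin, abs_of_pos (by positivity),
      smul_eq_mul] at h2
    have h4 := mul_left_cancel₀ (by positivity) h2
    rw [h4, ← h1]
    rfl
  have hc := normConst_pos n hn a ha
  simp only [kernel]
  rw [integral_const_mul, key]
  unfold normConst at hc ⊢
  exact inv_mul_cancel₀ (inv_pos.1 hc).ne'

end PoissonType

namespace PoissonType


/-! Write P for `extension`, P* for its adjoint `coextension`, U = Pu, r = (n-a)/(n+a-2) and δ =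
2/(n+a-2). The right side of the equation is P*(U^{r+δ}), and p ≥ r+1 yields u^r ≤ B (P*(U^{r+δ}) +
1) locally. The a priori space L^{r+1}_loc is critical for this inequality, so plain iteration of
norm estimates gains nothing; smallness has to come from localization.

P maps L^t to L^{nt/(n-1)} (`exists_lintegral_extension_rpow_le`), so by duality w ↦ P*(V Pw) is
bounded on every L^t, 1 < t < ∞, with norm at most a constant times the L^n norm of V
(`exists_lintegral_coextension_mul_extension_le`). Since nδ = (r+1)n/(n-1), the potential V = U^δ is
in L^n near each boundary point, with small norm on a small half-ball. Jensen's inequality (Pω)^r ≤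
P(ω^r) makes the inequality linear in the r-th power of the unknown. The resulting operator
contracts both L^{(r+1)/r} and L^t, and regularity lifting
(`lintegral_rpow_ne_top_of_le_contraction`) moves the solution from the first space to the second.
Localization costs only a bounded error: a power of order at least n-a of a distance cutoff cancels
the singularity of the kernel.

With t large, U^{r+δ} is in L^{2n} near the boundary point, which makes P*(U^{r+δ}) locally bounded
(`exists_ball_coextension_le`); then u and U are locally bounded too. A difference of kernels gains
|y-z|^β at the price of a factor |x-(y,0)|^{-β}, integrable against the kernel for β < 1, so
P*(U^{r+δ}) is locally Hölder. It is also positive, so dividing by K and taking the (p-1)-th root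
keeps the regularity. -/

/-! ### Geometry of the kernel. -/

/-- The Euclidean distance in `ℝ^n` from `x` to the boundary point `(y, 0)`. -/
noncomputable def rad {n : ℕ} (y : Bdry n) (x : Bdry n × ℝ) : ℝ :=
  √(‖x.1 - y‖ ^ 2 + x.2 ^ 2)

/-- The product type carries the supremum norm, so the triangle inequalities for `rad` are imported
from the L² product. -/
theorem rad_eq_dist {n : ℕ} (y : Bdry n) (x : Bdry n × ℝ) :
    rad y x = dist (WithLp.toLp 2 x) (WithLp.toLp 2 (y, (0 : ℝ))) := by
  rw [WithLp.prod_dist_eq_of_L2]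
  simp [rad, dist_eq_norm]

theorem rad_zero {n : ℕ} (y z : Bdry n) : rad y (z, 0) = ‖z - y‖ := by
  simp [rad]

theorem rad_nonneg {n : ℕ} (y : Bdry n) (x : Bdry n × ℝ) : 0 ≤ rad y x := Real.sqrt_nonneg _

theorem height_le_rad {n : ℕ} (y : Bdry n) (x : Bdry n × ℝ) : x.2 ≤ rad y x :=
  Real.le_sqrt_of_sq_le (by nlinarith [sq_nonneg ‖x.1 - y‖])

theorem rad_pos {n : ℕ} (y : Bdry n) {x : Bdry n × ℝ} (hx : 0 < x.2) : 0 < rad y x :=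
  hx.trans_le (height_le_rad y x)

theorem rad_le_add {n : ℕ} (y z : Bdry n) (x : Bdry n × ℝ) : rad y x ≤ rad z x + rad y (z, 0) := by
  simp only [rad_eq_dist]
  exact dist_triangle _ _ _

theorem measurableSet_halfSpace (n : ℕ) : MeasurableSet (halfSpace n) :=
  measurableSet_lt measurable_const measurable_snd

theorem kernel_eq {n : ℕ} {a : ℝ} (y : Bdry n) (x : Bdry n × ℝ) :
    kernel n a y x = normConst n a * (x.2 ^ (1 - a) / rad y x ^ ((n : ℝ) - a)) := by
  have h : rad y x ^ ((n : ℝ) - a) = (‖x.1 - y‖ ^ 2 + x.2 ^ 2) ^ (((n : ℝ) - a) / 2) := by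
    rw [rad, Real.sqrt_eq_rpow, ← Real.rpow_mul (by positivity)]
    congr 1; ring
  rw [kernel, rawKernel, h]

theorem kernel_pos {n : ℕ} (hn : 2 ≤ n) {a : ℝ} (ha : a < 1) (y : Bdry n) {x : Bdry n × ℝ}
    (hx : 0 < x.2) : 0 < kernel n a y x := by
  rw [kernel_eq]
  have := normConst_pos n (by omega) a ha
  have := rad_pos y hx
  positivity

/-- The distance to a boundary point is at least the height, and (1-a) - (n-a) = -(n-1). The
parameter a survives only in the constant. -/
theorem kernel_le_height {n : ℕ} (hn : 2 ≤ n) {a : ℝ} (ha : a < 1) (y : Bdry n)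
    {x : Bdry n × ℝ} (hx : 0 < x.2) :
    kernel n a y x ≤ normConst n a * x.2 ^ (-((n : ℝ) - 1)) := by
  rw [kernel_eq]
  have hc := normConst_pos n (by omega) a ha
  have hn' : (2 : ℝ) ≤ n := by exact_mod_cast hn
  refine mul_le_mul_of_nonneg_left ?_ hc.le
  have h1 : x.2 ^ (-((n : ℝ) - 1)) = x.2 ^ (1 - a) / x.2 ^ ((n : ℝ) - a) := by
    rw [← Real.rpow_sub hx]; congr 1; ring
  rw [h1]
  have := Real.rpow_le_rpow hx.le (height_le_rad y x) (z := (n : ℝ) - a) (by linarith)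
  gcongr

/-! ### The extension operator, its adjoint and their duality. -/

/-- The kernel with values in `[0, ∞]`. -/
noncomputable abbrev ekernel (n : ℕ) (a : ℝ) (y : Bdry n) (x : Bdry n × ℝ) : ℝ≥0∞ :=
  ENNReal.ofReal (kernel n a y x)

theorem measurable_ekernel (n : ℕ) (a : ℝ) :
    Measurable (fun z : Bdry n × (Bdry n × ℝ) => ekernel n a z.1 z.2) := by
  unfold ekernel kernel rawKernel
  fun_prop

@[fun_prop]
theorem measurable_ekernel_left (n : ℕ) (a : ℝ) (y : Bdry n) : Measurable (ekernel n a y) :=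
  (measurable_ekernel n a).comp measurable_prodMk_left

@[fun_prop]
theorem measurable_ekernel_right (n : ℕ) (a : ℝ) (x : Bdry n × ℝ) :
    Measurable (fun y => ekernel n a y x) :=
  (measurable_ekernel n a).comp measurable_prodMk_right

theorem lintegral_ekernel {n : ℕ} (hn : 2 ≤ n) {a : ℝ} (ha : a < 1) {x : Bdry n × ℝ}
    (hx : 0 < x.2) : ∫⁻ y, ekernel n a y x = 1 := by
  have h := integral_kernel n (by omega) a ha x hx
  have hi : Integrable (fun y => kernel n a y x) := by
    by_contra hcon
    rw [integral_undef hcon] at h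
    exact zero_ne_one h
  rw [← ofReal_integral_eq_lintegral_ofReal hi
    (Eventually.of_forall fun y => (kernel_pos hn ha y hx).le), h, ENNReal.ofReal_one]

theorem ekernel_symm (n : ℕ) (a : ℝ) (y z : Bdry n) (t : ℝ) :
    ekernel n a y (z, t) = ekernel n a z (y, t) := by
  simp only [ekernel, kernel, rawKernel, norm_sub_rev z y]

/-- At fixed height the kernel is symmetric in its two boundary variables, so its normalization also
holds on horizontal slices. Hence an extension has on each slice the mass of its boundary datum. -/
theorem lintegral_ekernel_slice {n : ℕ} (hn : 2 ≤ n) {a : ℝ} (ha : a < 1) (y : Bdry n) {t : ℝ}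
    (ht : 0 < t) : ∫⁻ z, ekernel n a y (z, t) = 1 := by
  simp_rw [ekernel_symm n a y]
  exact lintegral_ekernel hn ha (x := (y, t)) ht

/-- The extension operator `w ↦ ∫ P_a(y', ·) w(y') dy'` on functions with values in `[0, ∞]`. -/
noncomputable def extension (n : ℕ) (a : ℝ) (w : Bdry n → ℝ≥0∞) (x : Bdry n × ℝ) : ℝ≥0∞ :=
  ∫⁻ y, ekernel n a y x * w y

/-- The adjoint of `extension`, that is `g ↦ ∫_{ℝ^n_+} P_a(·, x) g(x) dx`. -/
noncomputable def coextension (n : ℕ) (a : ℝ) (g : Bdry n × ℝ → ℝ≥0∞) (y : Bdry n) : ℝ≥0∞ :=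
  ∫⁻ x in halfSpace n, ekernel n a y x * g x

theorem measurable_extension (n : ℕ) (a : ℝ) {w : Bdry n → ℝ≥0∞} (hw : Measurable w) :
    Measurable (extension n a w) := by
  have h : Measurable (fun z : (Bdry n × ℝ) × Bdry n => ekernel n a z.2 z.1 * w z.2) :=
    ((measurable_ekernel n a).comp measurable_swap).mul (hw.comp measurable_snd)
  exact h.lintegral_prod_right'

theorem measurable_coextension (n : ℕ) (a : ℝ) {g : Bdry n × ℝ → ℝ≥0∞} (hg : Measurable g) :
    Measurable (coextension n a g) := by
  have h : Measurable (fun z : Bdry n × (Bdry n × ℝ) => ekernel n a z.1 z.2 * g z.2) :=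
    (measurable_ekernel n a).mul (hg.comp measurable_snd)
  exact h.lintegral_prod_right'

theorem extension_congr {n : ℕ} {a : ℝ} {w w' : Bdry n → ℝ≥0∞} (h : w =ᵐ[volume] w') :
    extension n a w = extension n a w' := by
  ext x
  exact lintegral_congr_ae (h.mono fun y hy => by simp only [hy])

theorem extension_mono {n : ℕ} {a : ℝ} {w w' : Bdry n → ℝ≥0∞} (h : ∀ᵐ y, w y ≤ w' y)
    (x : Bdry n × ℝ) : extension n a w x ≤ extension n a w' x :=
  lintegral_mono_ae (h.mono fun y hy => by gcongr)

theorem extension_add {n : ℕ} {a : ℝ} {w w' : Bdry n → ℝ≥0∞} (hw : Measurable w)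
    (x : Bdry n × ℝ) : extension n a (w + w') x = extension n a w x + extension n a w' x := by
  simp only [extension, Pi.add_apply, mul_add]
  exact lintegral_add_left (by fun_prop) _

theorem extension_le_const {n : ℕ} (hn : 2 ≤ n) {a : ℝ} (ha : a < 1) {w : Bdry n → ℝ≥0∞}
    {M : ℝ≥0∞} (h : ∀ᵐ y, w y ≤ M) {x : Bdry n × ℝ} (hx : 0 < x.2) : extension n a w x ≤ M := by
  calc extension n a w x ≤ ∫⁻ y, ekernel n a y x * M :=
        lintegral_mono_ae (h.mono fun y hy => by gcongr)
    _ = M := by rw [lintegral_mul_const _ (by fun_prop), lintegral_ekernel hn ha hx, one_mul]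

theorem coextension_mono {n : ℕ} {a : ℝ} {g g' : Bdry n × ℝ → ℝ≥0∞}
    (h : ∀ x ∈ halfSpace n, g x ≤ g' x) (y : Bdry n) :
    coextension n a g y ≤ coextension n a g' y :=
  setLIntegral_mono' (measurableSet_halfSpace n) fun x hx => by gcongr; exact h x hx

theorem coextension_add {n : ℕ} {a : ℝ} {g g' : Bdry n × ℝ → ℝ≥0∞} (hg : Measurable g)
    (y : Bdry n) :
    coextension n a (g + g') y = coextension n a g y + coextension n a g' y := by
  simp only [coextension, Pi.add_apply, mul_add]
  exact lintegral_add_left (by fun_prop) _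

theorem coextension_const_mul {n : ℕ} {a : ℝ} {g : Bdry n × ℝ → ℝ≥0∞} (hg : Measurable g)
    (c : ℝ≥0∞) (y : Bdry n) :
    coextension n a (fun x => c * g x) y = c * coextension n a g y := by
  simp only [coextension]
  rw [← lintegral_const_mul _ (by fun_prop)]
  congr 1 with x
  ring

/-- `extension` and `coextension` are adjoint. -/
theorem lintegral_coextension_mul {n : ℕ} {a : ℝ} {g : Bdry n × ℝ → ℝ≥0∞} (hg : Measurable g)
    {w : Bdry n → ℝ≥0∞} (hw : Measurable w) :
    ∫⁻ y, coextension n a g y * w y = ∫⁻ x in halfSpace n, g x * extension n a w x := by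
  have h : Measurable (fun z : Bdry n × (Bdry n × ℝ) => ekernel n a z.1 z.2 * g z.2 * w z.1) :=
    ((measurable_ekernel n a).mul (hg.comp measurable_snd)).mul (hw.comp measurable_fst)
  calc ∫⁻ y, coextension n a g y * w y
      = ∫⁻ y, ∫⁻ x in halfSpace n, ekernel n a y x * g x * w y := by
        refine lintegral_congr fun y => ?_
        rw [coextension, lintegral_mul_const _ (by fun_prop)]
    _ = ∫⁻ x in halfSpace n, ∫⁻ y, ekernel n a y x * g x * w y :=
        lintegral_lintegral_swap h.aemeasurable
    _ = _ := by
        refine lintegral_congr fun x => ?_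
        rw [extension, ← lintegral_const_mul _ (by fun_prop)]
        exact lintegral_congr fun y => by ring

theorem setLIntegral_halfSpace {n : ℕ} {F : Bdry n × ℝ → ℝ≥0∞} (hF : Measurable F) :
    ∫⁻ x in halfSpace n, F x = ∫⁻ t in Set.Ioi (0 : ℝ), ∫⁻ z, F (z, t) := by
  have hs : halfSpace n = Set.univ ×ˢ Set.Ioi (0 : ℝ) := by
    ext x; simp [halfSpace]
  rw [hs, Measure.volume_eq_prod, ← Measure.prod_restrict, Measure.restrict_univ,
    lintegral_prod_symm _ hF.aemeasurable]


/-! ### Layer-cake integration. -/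

theorem lintegral_Ioo_rpow {q : ℝ} (hq : 0 < q) {M : ℝ} (hM : 0 ≤ M) :
    ∫⁻ t in Set.Ioo 0 M, ENNReal.ofReal (t ^ (q - 1)) = ENNReal.ofReal (M ^ q / q) := by
  have hint : IntervalIntegrable (fun t : ℝ => t ^ (q - 1)) volume 0 M :=
    intervalIntegral.intervalIntegrable_rpow' (by linarith)
  rw [setLIntegral_congr Ioo_ae_eq_Ioc, ← ofReal_integral_eq_lintegral_ofReal,
    ← intervalIntegral.integral_of_le hM, integral_rpow (Or.inl (by linarith))]
  · simp [Real.zero_rpow hq.ne']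
  · exact (intervalIntegrable_iff_integrableOn_Ioc_of_le hM).1 hint
  · refine (ae_restrict_iff' measurableSet_Ioc).2 (Eventually.of_forall fun t ht => ?_)
    exact Real.rpow_nonneg ht.1.le _

theorem setLIntegral_rpow_lt {q : ℝ} (hq : 0 < q) (y : ℝ≥0∞) :
    ∫⁻ t in Set.Ioi (0 : ℝ), ENNReal.ofReal (t ^ (q - 1)) *
      {t : ℝ | ENNReal.ofReal t < y}.indicator 1 t = y ^ q / ENNReal.ofReal q := by
  have key : ∀ M : ℝ, 0 ≤ M → ENNReal.ofReal M ^ q / ENNReal.ofReal q =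
      ∫⁻ t in Set.Ioi (0 : ℝ), ENNReal.ofReal (t ^ (q - 1)) *
        {t : ℝ | ENNReal.ofReal t < ENNReal.ofReal M}.indicator 1 t := by
    intro M hM
    rw [ENNReal.ofReal_rpow_of_nonneg hM hq.le, ← ENNReal.ofReal_div_of_pos hq,
      ← lintegral_Ioo_rpow hq hM, ← Set.Ioi_inter_Iio, Set.inter_comm,
      ← Measure.restrict_restrict measurableSet_Iio, ← lintegral_indicator measurableSet_Iio]
    refine setLIntegral_congr_fun measurableSet_Ioi fun t ht => ?_
    have : ENNReal.ofReal t < ENNReal.ofReal M ↔ t < M :=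
      ENNReal.ofReal_lt_ofReal_iff_of_nonneg (le_of_lt ht)
    by_cases h : t < M
    · simp [Set.indicator, this, h]
    · simp [Set.indicator, this, h]
  induction y with
  | coe y =>
    have := key y y.2
    rw [ENNReal.ofReal_coe_nnreal] at this
    exact this.symm
  | top =>
    rw [ENNReal.top_rpow_of_pos hq, ENNReal.top_div_of_ne_top ENNReal.ofReal_ne_top]
    refine ENNReal.eq_top_of_forall_nnreal_le fun r => ?_
    -- Chosen so that M^q / q = r; the integral for y = ∞ then exceeds every finite r by comparison
    -- with level M.
    set M : ℝ := (r * q) ^ (1 / q) with hMdef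
    have hM : 0 ≤ M := by positivity
    have hval : ENNReal.ofReal M ^ q / ENNReal.ofReal q = r := by
      rw [ENNReal.ofReal_rpow_of_nonneg hM hq.le, ← ENNReal.ofReal_div_of_pos hq, hMdef,
        ← Real.rpow_mul (by positivity), one_div_mul_cancel hq.ne', Real.rpow_one,
        mul_div_cancel_right₀ _ hq.ne', ENNReal.ofReal_coe_nnreal]
    rw [← hval, key M hM]
    refine lintegral_mono fun t => ?_
    gcongr
    exact le_top

/-- Layer-cake formula for functions with values in `[0, ∞]`. -/
theorem lintegral_rpow_eq_lintegral_lt {α : Type*} [MeasurableSpace α] (μ : Measure α) [SFinite μ]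
    {g f : α → ℝ≥0∞} (hg : Measurable g) (hf : Measurable f) {q : ℝ} (hq : 0 < q) :
    ∫⁻ x, g x * (f x ^ q / ENNReal.ofReal q) ∂μ =
      ∫⁻ t in Set.Ioi (0 : ℝ), ENNReal.ofReal (t ^ (q - 1)) *
        ∫⁻ x in {x | ENNReal.ofReal t < f x}, g x ∂μ := by
  have hS : MeasurableSet {z : α × ℝ | ENNReal.ofReal z.2 < f z.1} :=
    measurableSet_lt (by fun_prop) (by fun_prop)
  have h : Measurable (fun z : α × ℝ => g z.1 * (ENNReal.ofReal (z.2 ^ (q - 1)) *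
      {z : α × ℝ | ENNReal.ofReal z.2 < f z.1}.indicator 1 z)) := by
    refine (hg.comp measurable_fst).mul (Measurable.mul (by fun_prop) ?_)
    exact measurable_one.indicator hS
  calc ∫⁻ x, g x * (f x ^ q / ENNReal.ofReal q) ∂μ
      = ∫⁻ x, (∫⁻ t in Set.Ioi (0 : ℝ), g x * (ENNReal.ofReal (t ^ (q - 1)) *
          {z : α × ℝ | ENNReal.ofReal z.2 < f z.1}.indicator 1 (x, t))) ∂μ := by
        refine lintegral_congr fun x => ?_
        rw [← setLIntegral_rpow_lt hq, ← lintegral_const_mul]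
        · rfl
        · refine Measurable.mul (by fun_prop) (measurable_one.indicator ?_)
          exact measurableSet_lt (by fun_prop) (by fun_prop)
    _ = ∫⁻ t in Set.Ioi (0 : ℝ), ∫⁻ x, g x * (ENNReal.ofReal (t ^ (q - 1)) *
          {z : α × ℝ | ENNReal.ofReal z.2 < f z.1}.indicator 1 (x, t)) ∂μ :=
        lintegral_lintegral_swap h.aemeasurable
    _ = _ := by
        refine lintegral_congr fun t => ?_
        rw [← lintegral_indicator (measurableSet_lt (by fun_prop) (by fun_prop)),
          ← lintegral_const_mul _ (hg.indicator (measurableSet_lt (by fun_prop) (by fun_prop)))]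
        refine lintegral_congr fun x => ?_
        by_cases hx : ENNReal.ofReal t < f x
        · simp [Set.indicator, hx, mul_comm]
        · simp [Set.indicator, hx]

/-! ### Weak and strong bounds for the extension operator. -/

theorem extension_le_height {n : ℕ} (hn : 2 ≤ n) {a : ℝ} (ha : a < 1) {w : Bdry n → ℝ≥0∞}
    (hw : Measurable w) {x : Bdry n × ℝ} (hx : 0 < x.2) :
    extension n a w x ≤
      ENNReal.ofReal (normConst n a) * (ENNReal.ofReal x.2 ^ ((n : ℝ) - 1))⁻¹ * ∫⁻ y, w y := by
  rw [← lintegral_const_mul _ hw]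
  refine lintegral_mono fun y => ?_
  refine mul_le_mul_left ?_ _
  rw [← ENNReal.rpow_neg, ENNReal.ofReal_rpow_of_pos hx,
    ← ENNReal.ofReal_mul (normConst_pos n (by omega) a ha).le]
  exact ENNReal.ofReal_le_ofReal (kernel_le_height hn ha y hx)

/-- The extension operator is of weak type `(1, n / (n - 1))`. -/
theorem volume_lt_extension_le {n : ℕ} (hn : 2 ≤ n) {a : ℝ} (ha : a < 1) {w : Bdry n → ℝ≥0∞}
    (hw : Measurable w) {b : ℝ≥0∞} (hb : b ≠ 0) (hb' : b ≠ ⊤) :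
    volume.restrict (halfSpace n) {x | b < extension n a w x} ≤
      (ENNReal.ofReal (normConst n a) * (∫⁻ y, w y) / b) ^ (1 / ((n : ℝ) - 1)) *
        ((∫⁻ y, w y) / b) := by
  have hn' : (2 : ℝ) ≤ n := by exact_mod_cast hn
  have hc := normConst_pos n (by omega) a ha
  have hd : 0 < (n : ℝ) - 1 := by linarith
  set I := ∫⁻ y, w y with hI
  by_cases hItop : I = ⊤
  · rw [hItop, ENNReal.mul_top (by simpa using hc), ENNReal.top_div_of_ne_top hb',
      ENNReal.top_rpow_of_pos (by positivity)]
    simp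
  set A := ENNReal.ofReal (normConst n a) * I / b with hA
  have hAtop : A ≠ ⊤ := ENNReal.div_ne_top (ENNReal.mul_ne_top ENNReal.ofReal_ne_top hItop) hb
  have hA1top : A ^ (1 / ((n : ℝ) - 1)) ≠ ⊤ := ENNReal.rpow_ne_top_of_nonneg (by positivity) hAtop
  -- The height above which the pointwise bound `extension_le_height` is already at most b. The
  -- superlevel set lies below it, and there Chebyshev's inequality bounds every slice by I / b.
  set τ := (A ^ (1 / ((n : ℝ) - 1))).toReal with hτ
  have hext := measurable_extension n a hw
  have hS : MeasurableSet {x | b < extension n a w x} := measurableSet_lt measurable_const hext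
  have hslice : ∀ t ∈ Set.Ioi (0 : ℝ), ∫⁻ z, {x | b < extension n a w x}.indicator 1 (z, t) ≤
      (Set.Ioc 0 τ).indicator (fun _ => I / b) t := by
    intro t ht
    have ht : 0 < t := ht
    by_cases htτ : t ≤ τ
    · rw [Set.indicator_of_mem (show t ∈ Set.Ioc 0 τ from ⟨ht, htτ⟩)]
      have h1 : ∫⁻ z, {x | b < extension n a w x}.indicator 1 (z, t) =
          volume {z | b < extension n a w (z, t)} := by
        rw [← lintegral_indicator_one (measurableSet_lt measurable_const (by fun_prop))]
        rfl
      rw [h1]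
      have h2 : ∫⁻ z, extension n a w (z, t) = I := by
        simp only [extension]
        rw [lintegral_lintegral_swap]
        · rw [hI]
          refine lintegral_congr fun y => ?_
          have hm : Measurable (fun z => ekernel n a y (z, t)) :=
            (measurable_ekernel_left n a y).comp (by fun_prop)
          rw [lintegral_mul_const _ hm, lintegral_ekernel_slice hn ha y ht, one_mul]
        · refine Measurable.aemeasurable ?_
          refine Measurable.mul ?_ (hw.comp measurable_snd)
          exact (measurable_ekernel n a).comp (f := fun z : Bdry n × Bdry n => (z.2, (z.1, t)))
            (by fun_prop)
      rw [← h2]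
      refine le_trans (measure_mono fun z hz => ?_)
        (meas_ge_le_lintegral_div (by fun_prop) hb hb')
      exact le_of_lt (show b < extension n a w (z, t) from hz)
    · have h0 : ∀ z, {x | b < extension n a w x}.indicator (1 : Bdry n × ℝ → ℝ≥0∞) (z, t) = 0 := by
        intro z
        rw [Set.indicator_of_notMem]
        simp only [Set.mem_ofPred_eq, not_lt]
        refine (extension_le_height hn ha hw (x := (z, t)) ht).trans ?_
        have h3 : A ^ (1 / ((n : ℝ) - 1)) ≤ ENNReal.ofReal t :=
          ENNReal.le_ofReal_iff_toReal_le hA1top ht.le |>.2 (not_le.1 htτ).le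
        have h4 : A ≤ ENNReal.ofReal t ^ ((n : ℝ) - 1) := by
          rw [one_div] at h3
          exact (ENNReal.rpow_inv_le_iff hd).1 h3
        have ht0 : ENNReal.ofReal t ^ ((n : ℝ) - 1) ≠ 0 := by
          simp [ENNReal.rpow_eq_zero_iff, ht]
        have ht1 : ENNReal.ofReal t ^ ((n : ℝ) - 1) ≠ ⊤ :=
          ENNReal.rpow_ne_top_of_nonneg hd.le ENNReal.ofReal_ne_top
        rw [mul_right_comm, ← div_eq_mul_inv, ENNReal.div_le_iff ht0 ht1, mul_comm b]
        rwa [hA, ENNReal.div_le_iff hb hb'] at h4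
      simp [h0]
  calc volume.restrict (halfSpace n) {x | b < extension n a w x}
      = ∫⁻ x in halfSpace n, {x | b < extension n a w x}.indicator 1 x :=
        (lintegral_indicator_one hS).symm
    _ = ∫⁻ t in Set.Ioi (0 : ℝ), ∫⁻ z, {x | b < extension n a w x}.indicator 1 (z, t) :=
        setLIntegral_halfSpace (measurable_one.indicator hS)
    _ ≤ ∫⁻ t in Set.Ioi (0 : ℝ), (Set.Ioc 0 τ).indicator (fun _ => I / b) t :=
        setLIntegral_mono' measurableSet_Ioi hslice
    _ ≤ ∫⁻ t, (Set.Ioc 0 τ).indicator (fun _ => I / b) t := setLIntegral_le_lintegral _ _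
    _ = A ^ (1 / ((n : ℝ) - 1)) * (I / b) := by
        rw [lintegral_indicator_const measurableSet_Ioc, Real.volume_Ioc, sub_zero, hτ,
          ENNReal.ofReal_toReal hA1top, mul_comm]

theorem setLIntegral_lt_mul_rpow_le {α : Type*} [MeasurableSpace α] {μ : Measure α}
    {w : α → ℝ≥0∞} (hw : Measurable w) {t : ℝ} (ht : 1 < t) (b : ℝ≥0∞) :
    (∫⁻ y in {y | b < w y}, w y ∂μ) * b ^ (t - 1) ≤ ∫⁻ y, w y ^ t ∂μ := by
  rw [← lintegral_mul_const _ hw]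
  refine le_trans (setLIntegral_mono' (measurableSet_lt measurable_const hw) (g := fun y => w y ^ t)
    fun y hy => ?_) (setLIntegral_le_lintegral _ _)
  have hy : b < w y := hy
  calc w y * b ^ (t - 1) ≤ w y * w y ^ (t - 1) := by gcongr
    _ = w y ^ t := by
      nth_rewrite 1 [← ENNReal.rpow_one (w y)]
      rw [← ENNReal.rpow_add_of_nonneg _ _ zero_le_one (by linarith)]
      congr 1; ring

/-- Cut w at height b. The low part extends to at most b because the kernel has mass one, so only
the tall part can push the extension above 2b. In its weak-type bound the mass appears to the power
1 + 1/(n-1); the fractional power is traded for the L^t norm by Chebyshev, and one linear factor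
remains, so that integrating over levels reproduces the L^t norm. -/
theorem volume_lt_extension_le_of_rpow {n : ℕ} (hn : 2 ≤ n) {a : ℝ} (ha : a < 1) {t : ℝ}
    (ht : 1 < t) {w : Bdry n → ℝ≥0∞} (hw : Measurable w) {b : ℝ≥0∞} (hb : b ≠ 0) (hb' : b ≠ ⊤) :
    volume.restrict (halfSpace n) {x | 2 * b < extension n a w x} ≤
      (ENNReal.ofReal (normConst n a) * (∫⁻ y, w y ^ t)) ^ (1 / ((n : ℝ) - 1)) *
        (b ^ (t * (1 / ((n : ℝ) - 1)) + 1))⁻¹ * ∫⁻ y in {y | b < w y}, w y := by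
  have hn' : (2 : ℝ) ≤ n := by exact_mod_cast hn
  have hd : 0 < (n : ℝ) - 1 := by linarith
  set e := 1 / ((n : ℝ) - 1) with he
  have he0 : 0 < e := by positivity
  have hS : MeasurableSet {y | b < w y} := measurableSet_lt measurable_const hw
  set w1 := {y | b < w y}.indicator w with hw1
  have hw1m : Measurable w1 := hw.indicator hS
  have hIeq : ∫⁻ y, w1 y = ∫⁻ y in {y | b < w y}, w y := lintegral_indicator hS _
  have hsub : volume.restrict (halfSpace n) {x | 2 * b < extension n a w x} ≤
      volume.restrict (halfSpace n) {x | b < extension n a w1 x} := by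
    refine measure_mono_ae ((ae_restrict_iff' (measurableSet_halfSpace n)).2
      (Eventually.of_forall fun x hx hlt => ?_))
    have hlt : 2 * b < extension n a w x := hlt
    show b < extension n a w1 x
    have hle : extension n a w x ≤ b + extension n a w1 x := by
      have h1 : ∀ y, w y ≤ ((fun _ => b : Bdry n → ℝ≥0∞) + w1) y := by
        intro y
        by_cases hy : b < w y
        · simp [hw1, Set.indicator, hy]
        · simpa [hw1, Set.indicator, hy] using not_lt.1 hy
      refine (extension_mono (Eventually.of_forall h1) x).trans ?_
      rw [extension_add measurable_const]
      gcongr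
      exact extension_le_const hn ha (Eventually.of_forall fun _ => le_rfl) hx
    by_contra hcon
    refine absurd (hlt.trans_le (hle.trans (add_le_add le_rfl (not_lt.1 hcon)))) ?_
    rw [two_mul]; exact lt_irrefl _
  refine hsub.trans ((volume_lt_extension_le hn ha hw1m hb hb').trans ?_)
  rw [hIeq]
  have hI := setLIntegral_lt_mul_rpow_le (μ := (volume : Measure (Bdry n))) hw ht b
  set I := ∫⁻ y in {y | b < w y}, w y
  set A := ∫⁻ y, w y ^ t
  have hIb : I / b ≤ A * (b ^ t)⁻¹ := by
    have hbt0 : b ^ t ≠ 0 := by simp [ENNReal.rpow_eq_zero_iff, hb, hb']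
    have hbt1 : b ^ t ≠ ⊤ := ENNReal.rpow_ne_top_of_nonneg (by linarith) hb'
    rw [← div_eq_mul_inv, ENNReal.le_div_iff_mul_le (Or.inl hbt0) (Or.inl hbt1)]
    refine le_trans (le_of_eq ?_) hI
    rw [div_eq_mul_inv, mul_assoc, ← ENNReal.rpow_neg_one, ← ENNReal.rpow_add _ _ hb hb']
    congr 2; ring
  calc (ENNReal.ofReal (normConst n a) * I / b) ^ e * (I / b)
      ≤ (ENNReal.ofReal (normConst n a) * (A * (b ^ t)⁻¹)) ^ e * (I / b) := by
        rw [mul_div_assoc]; gcongr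
    _ = (ENNReal.ofReal (normConst n a) * A) ^ e * (b ^ (t * e + 1))⁻¹ * I := by
        rw [← mul_assoc, ENNReal.mul_rpow_of_nonneg _ _ he0.le, ENNReal.inv_rpow,
          ← ENNReal.rpow_mul, ENNReal.rpow_add _ _ hb hb', ENNReal.rpow_one,
          ENNReal.mul_inv (Or.inr hb') (Or.inr hb), div_eq_mul_inv]
        ring

/-- The extension operator maps `L^r` to `L^{nr / (n - 1)}` for `1 < r < ∞`. -/
theorem exists_lintegral_extension_rpow_le {n : ℕ} (hn : 2 ≤ n) {a : ℝ} (ha : a < 1) {r : ℝ}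
    (hr : 1 < r) : ∃ C : ℝ≥0∞, C ≠ ⊤ ∧ ∀ w : Bdry n → ℝ≥0∞, Measurable w →
      ∫⁻ x in halfSpace n, extension n a w x ^ (r * (1 + 1 / ((n : ℝ) - 1))) ≤
        C * (∫⁻ y, w y ^ r) ^ (1 + 1 / ((n : ℝ) - 1)) := by
  have hn' : (2 : ℝ) ≤ n := by exact_mod_cast hn
  have hd : 0 < (n : ℝ) - 1 := by linarith
  set e := 1 / ((n : ℝ) - 1) with he
  have he0 : 0 < e := by positivity
  set q := r * (1 + e) with hq
  have hq0 : 0 < q := by positivity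
  have hr1 : 0 < r - 1 := by linarith
  set c := ENNReal.ofReal (normConst n a)
  have hrq0 : ENNReal.ofReal q ≠ 0 := by simpa using hq0
  refine ⟨ENNReal.ofReal q * (ENNReal.ofReal (2 ^ (r * e + 1)) * c ^ e *
    (2 ^ (r - 1) / ENNReal.ofReal (r - 1))), ?_, fun w hw => ?_⟩
  · refine ENNReal.mul_ne_top ENNReal.ofReal_ne_top (ENNReal.mul_ne_top (ENNReal.mul_ne_top
      ENNReal.ofReal_ne_top (ENNReal.rpow_ne_top_of_nonneg he0.le ENNReal.ofReal_ne_top)) ?_)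
    refine ENNReal.div_ne_top (ENNReal.rpow_ne_top_of_nonneg hr1.le (by simp)) ?_
    simpa using hr
  set A := ∫⁻ y, w y ^ r with hA
  have hext := measurable_extension n a hw
  have hlc := lintegral_rpow_eq_lintegral_lt (volume.restrict (halfSpace n))
    (g := fun _ => 1) measurable_const hext hq0
  simp only [one_mul, setLIntegral_one] at hlc
  have hlc2 := lintegral_rpow_eq_lintegral_lt (volume : Measure (Bdry n))
    -- The factor 2 matches the cut: level s of the extension is controlled by the part of w above s
    -- / 2.
    (g := w) (f := fun y => 2 * w y) hw (by fun_prop) hr1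
  have hA2 : ∫⁻ y, w y * ((2 * w y) ^ (r - 1) / ENNReal.ofReal (r - 1)) =
      2 ^ (r - 1) / ENNReal.ofReal (r - 1) * A := by
    rw [hA, ← lintegral_const_mul _ (by fun_prop)]
    refine lintegral_congr fun y => ?_
    have : w y ^ r = w y * w y ^ (r - 1) := by
      nth_rewrite 2 [← ENNReal.rpow_one (w y)]
      rw [← ENNReal.rpow_add_of_nonneg _ _ zero_le_one hr1.le]
      congr 1; ring
    rw [this, ENNReal.mul_rpow_of_nonneg _ _ hr1.le]
    simp only [div_eq_mul_inv]
    ring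
  have hlevel : ∀ s ∈ Set.Ioi (0 : ℝ), ENNReal.ofReal (s ^ (q - 1)) *
      volume.restrict (halfSpace n) {x | ENNReal.ofReal s < extension n a w x} ≤
      ENNReal.ofReal (2 ^ (r * e + 1)) * (c * A) ^ e * (ENNReal.ofReal (s ^ (r - 1 - 1)) *
        ∫⁻ y in {y | ENNReal.ofReal s < 2 * w y}, w y) := by
    intro s hs
    have hs : 0 < s := hs
    have hsb : ENNReal.ofReal s = 2 * ENNReal.ofReal (s / 2) := by
      rw [← ENNReal.ofReal_ofNat 2, ← ENNReal.ofReal_mul zero_le_two]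
      congr 1; ring
    have hset : {y | ENNReal.ofReal s < 2 * w y} = {y | ENNReal.ofReal (s / 2) < w y} := by
      ext y
      simp only [Set.mem_ofPred_eq, hsb]
      exact ENNReal.mul_lt_mul_iff_right (by simp) (by simp)
    have hv := volume_lt_extension_le_of_rpow hn ha hr hw (b := ENNReal.ofReal (s / 2))
      (by simpa using hs) ENNReal.ofReal_ne_top
    rw [← hsb] at hv
    rw [hset]
    -- The powers of s combine to q - 1 - (re + 1) = r - 2, the layer-cake weight for the exponent r
    -- - 1.
    have hpow : ENNReal.ofReal (s ^ (q - 1)) * (ENNReal.ofReal (s / 2) ^ (r * e + 1))⁻¹ =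
        ENNReal.ofReal (2 ^ (r * e + 1)) * ENNReal.ofReal (s ^ (r - 1 - 1)) := by
      rw [← ENNReal.rpow_neg, ENNReal.ofReal_rpow_of_pos (by positivity),
        ← ENNReal.ofReal_mul (by positivity), ← ENNReal.ofReal_mul (by positivity)]
      congr 1
      rw [Real.div_rpow hs.le zero_le_two, Real.rpow_neg zero_le_two, div_inv_eq_mul,
        ← mul_assoc, ← Real.rpow_add hs, mul_comm]
      congr 2
      rw [hq]; ring
    calc _ ≤ ENNReal.ofReal (s ^ (q - 1)) * ((c * A) ^ e *
          (ENNReal.ofReal (s / 2) ^ (r * e + 1))⁻¹ *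
            ∫⁻ y in {y | ENNReal.ofReal (s / 2) < w y}, w y) := by gcongr
      _ = (ENNReal.ofReal (s ^ (q - 1)) * (ENNReal.ofReal (s / 2) ^ (r * e + 1))⁻¹) *
          ((c * A) ^ e * ∫⁻ y in {y | ENNReal.ofReal (s / 2) < w y}, w y) := by ring
      _ = _ := by rw [hpow]; ring
  have hmain : ∫⁻ x in halfSpace n, extension n a w x ^ q / ENNReal.ofReal q ≤
      ENNReal.ofReal (2 ^ (r * e + 1)) * c ^ e * (2 ^ (r - 1) / ENNReal.ofReal (r - 1)) *
        A ^ (1 + e) := by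
    rw [hlc]
    refine (setLIntegral_mono' measurableSet_Ioi hlevel).trans ?_
    -- For infinite A the bound is trivial, provided that the constant in front is not zero.
    by_cases hAtop : A = ⊤
    · by_cases h0 : ENNReal.ofReal (2 ^ (r * e + 1)) * c ^ e *
        (2 ^ (r - 1) / ENNReal.ofReal (r - 1)) = 0
      · exfalso
        have hc : c ≠ 0 := by simpa [c] using normConst_pos n (by omega) a ha
        refine mul_ne_zero (mul_ne_zero ?_ ?_) ?_ h0
        · simp only [ne_eq, ENNReal.ofReal_eq_zero, not_le]; positivity
        · simp [ENNReal.rpow_eq_zero_iff, hc, c]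
        · simp [ENNReal.rpow_eq_zero_iff]
      · rw [hAtop, ENNReal.top_rpow_of_pos (by positivity), ENNReal.mul_top h0]
        exact le_top
    · have hfin : ENNReal.ofReal (2 ^ (r * e + 1)) * (c * A) ^ e ≠ ⊤ :=
        ENNReal.mul_ne_top ENNReal.ofReal_ne_top (ENNReal.rpow_ne_top_of_nonneg he0.le
          (ENNReal.mul_ne_top ENNReal.ofReal_ne_top hAtop))
      rw [lintegral_const_mul' _ _ hfin, ← hlc2, hA2,
        ENNReal.rpow_add_of_nonneg _ _ zero_le_one he0.le, ENNReal.rpow_one,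
        ENNReal.mul_rpow_of_nonneg _ _ he0.le]
      exact le_of_eq (by ring)
  have hdiv : ∫⁻ x in halfSpace n, extension n a w x ^ q =
      ENNReal.ofReal q * ∫⁻ x in halfSpace n, extension n a w x ^ q / ENNReal.ofReal q := by
    rw [← lintegral_const_mul _ (by fun_prop)]
    refine lintegral_congr fun x => ?_
    rw [ENNReal.mul_div_cancel hrq0 ENNReal.ofReal_ne_top]
  rw [hdiv, mul_assoc]
  gcongr


/-! ### Duality and bounds for the adjoint operator. -/

/-- Divide by X^{1/t'}. This is legitimate only for finite X, which is why the converse of Hölder's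
inequality is first proved for truncations. -/
theorem le_rpow_of_le_mul_rpow {t t' : ℝ} (ht : t.HolderConjugate t') {X C : ℝ≥0∞} (hX : X ≠ ⊤)
    (h : X ≤ C * X ^ (1 / t')) : X ≤ C ^ t := by
  by_cases hX0 : X = 0
  · simp [hX0]
  have e1 : X ^ (1 / t) * X ^ (1 / t') = X := by
    rw [← ENNReal.rpow_add _ _ hX0 hX, one_div, one_div, ht.inv_add_inv_eq_one, ENNReal.rpow_one]
  have hne : X ^ (1 / t') ≠ 0 := by simp [ENNReal.rpow_eq_zero_iff, hX0, hX]
  have hne' : X ^ (1 / t') ≠ ⊤ :=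
    ENNReal.rpow_ne_top_of_nonneg (one_div_nonneg.2 ht.symm.nonneg) hX
  nth_rewrite 1 [← e1] at h
  have h2 : X ^ (1 / t) ≤ C := (ENNReal.mul_le_mul_iff_left hne hne').1 h
  rw [one_div] at h2
  exact (ENNReal.rpow_inv_le_iff ht.pos).1 h2

/-- Converse of Hölder's inequality. -/
theorem lintegral_rpow_le_of_forall_lintegral_mul_le {α : Type*} [MeasurableSpace α]
    {μ : Measure α} [SigmaFinite μ] {t t' : ℝ} (ht : t.HolderConjugate t') {G : α → ℝ≥0∞}
    (hG : Measurable G) {C : ℝ≥0∞}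
    (h : ∀ H : α → ℝ≥0∞, Measurable H → ∫⁻ x, G x * H x ∂μ ≤ C * (∫⁻ x, H x ^ t' ∂μ) ^ (1 / t')) :
    ∫⁻ x, G x ^ t ∂μ ≤ C ^ t := by
  have ht0 := ht.pos
  have ht1 := ht.lt
  set S := spanningSets μ
  have hS : ∀ j, MeasurableSet (S j) := measurableSet_spanningSets μ
  -- Truncating in height and to a set of finite measure makes the t-th power integrable; the
  -- extremal test function g_j^{t-1} then gives a bound uniform in j.
  set g : ℕ → α → ℝ≥0∞ := fun j => (S j).indicator (fun x => min (G x) j) with hg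
  have hgm : ∀ j, Measurable (g j) := fun j => (hG.min measurable_const).indicator (hS j)
  have hgle : ∀ j x, g j x ≤ G x := by
    intro j x
    by_cases hx : x ∈ S j <;> simp [hg, hx]
  have hbound : ∀ j, ∫⁻ x, g j x ^ t ∂μ ≤ C ^ t := by
    intro j
    refine le_rpow_of_le_mul_rpow ht ?_ ?_
    · have h1 : ∀ x, g j x ^ t ≤ (S j).indicator (fun _ => (j : ℝ≥0∞) ^ t) x := by
        intro x
        by_cases hx : x ∈ S j
        · simp only [hg, Set.indicator_of_mem hx]
          gcongr
          exact min_le_right _ _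
        · simp [hg, hx, ht0]
      refine ne_top_of_le_ne_top ?_ (lintegral_mono h1)
      rw [lintegral_indicator_const (hS j)]
      exact ENNReal.mul_ne_top (ENNReal.rpow_ne_top_of_nonneg ht0.le (by simp))
        (measure_spanningSets_lt_top μ j).ne
    · have h2 := h (fun x => g j x ^ (t - 1)) (by have := hgm j; fun_prop)
      have h3 : ∀ x, (g j x ^ (t - 1)) ^ t' = g j x ^ t := by
        intro x
        rw [← ENNReal.rpow_mul, ht.sub_one_mul_conj]
      simp only [h3] at h2
      refine le_trans (lintegral_mono fun x => ?_) h2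
      calc g j x ^ t = g j x * g j x ^ (t - 1) := by
            nth_rewrite 2 [← ENNReal.rpow_one (g j x)]
            rw [← ENNReal.rpow_add_of_nonneg _ _ zero_le_one (by linarith)]
            congr 1; ring
        _ ≤ G x * g j x ^ (t - 1) := by gcongr; exact hgle j x
  have hmono : ∀ x, Monotone fun j => g j x := by
    intro x i j hij
    by_cases hx : x ∈ S i
    · have hx' : x ∈ S j := monotone_spanningSets μ hij hx
      simp only [hg, Set.indicator_of_mem hx, Set.indicator_of_mem hx']
      exact min_le_min le_rfl (by exact_mod_cast hij)
    · simp [hg, hx]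
  have hlim : ∀ x, Tendsto (fun j => g j x) atTop (nhds (G x)) := by
    intro x
    have hx : x ∈ ⋃ j, S j := by rw [iUnion_spanningSets]; trivial
    obtain ⟨i, hi⟩ := Set.mem_iUnion.1 hx
    have h1 : Tendsto (fun j : ℕ => min (G x) (j : ℝ≥0∞)) atTop (nhds (min (G x) ⊤)) :=
      tendsto_const_nhds.min ENNReal.tendsto_nat_nhds_top
    rw [min_top_right] at h1
    refine h1.congr' ?_
    filter_upwards [eventually_ge_atTop i] with j hj
    exact (Set.indicator_of_mem (monotone_spanningSets μ hj hi) fun x => min (G x) (j : ℝ≥0∞)).symm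
  have hint := lintegral_tendsto_of_tendsto_of_monotone (μ := μ) (f := fun j x => g j x ^ t)
    (F := fun x => G x ^ t) (fun j => by have := hgm j; fun_prop)
    (Eventually.of_forall fun x i j hij => by
      dsimp only; gcongr; exact hmono x hij)
    (Eventually.of_forall fun x =>
      (ENNReal.continuous_rpow_const.tendsto (G x)).comp (hlim x))
  exact le_of_tendsto' hint hbound

/-- Hölder's inequality for three functions. -/
theorem lintegral_mul_mul_le {α : Type*} [MeasurableSpace α] {μ : Measure α}
    {F G H : α → ℝ≥0∞} (hF : Measurable F) (hG : Measurable G) (hH : Measurable H)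
    {p q r : ℝ} (hp : 0 < p) (hq : 0 < q) (hr : 0 < r) (h : 1 / p + 1 / q + 1 / r = 1) :
    ∫⁻ x, F x * G x * H x ∂μ ≤ (∫⁻ x, F x ^ p ∂μ) ^ (1 / p) * (∫⁻ x, G x ^ q ∂μ) ^ (1 / q) *
      (∫⁻ x, H x ^ r ∂μ) ^ (1 / r) := by
  have := ENNReal.lintegral_prod_norm_pow_le (μ := μ) (Finset.univ : Finset (Fin 3))
    (f := ![fun x => F x ^ p, fun x => G x ^ q, fun x => H x ^ r])
    (fun i _ => by fin_cases i <;> simp <;> fun_prop) (p := ![1 / p, 1 / q, 1 / r])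
    (by simpa [Fin.sum_univ_three] using h)
    (fun i _ => by fin_cases i <;> simp <;> positivity)
  simpa [Fin.prod_univ_three, ← ENNReal.rpow_mul, hp.ne', hq.ne', hr.ne'] using this

/-- The map `g ↦ coextension (V * g)` from `L^{nt / (n - 1)}` to `L^t` for `V ∈ L^n`. -/
theorem exists_lintegral_coextension_rpow_le {n : ℕ} (hn : 2 ≤ n) {a : ℝ} (ha : a < 1) {t : ℝ}
    (ht : 1 < t) : ∃ C : ℝ≥0∞, C ≠ ⊤ ∧ ∀ V g : Bdry n × ℝ → ℝ≥0∞, Measurable V → Measurable g →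
      ∫⁻ y, coextension n a (fun x => V x * g x) y ^ t ≤
        (C * (∫⁻ x in halfSpace n, V x ^ (n : ℝ)) ^ (1 / (n : ℝ)) *
          (∫⁻ x in halfSpace n, g x ^ (t * (1 + 1 / ((n : ℝ) - 1)))) ^
            (1 / (t * (1 + 1 / ((n : ℝ) - 1))))) ^ t := by
  have hn' : (2 : ℝ) ≤ n := by exact_mod_cast hn
  have hd : 0 < (n : ℝ) - 1 := by linarith
  have hconj := Real.HolderConjugate.conjExponent ht
  set t' := t.conjExponent
  have ht' : 1 < t' := hconj.symm.lt
  obtain ⟨C, hC, hbd⟩ := exists_lintegral_extension_rpow_le hn ha ht'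
  set e := 1 / ((n : ℝ) - 1) with he
  have he0 : 0 < e := by positivity
  refine ⟨C ^ (1 / (t' * (1 + e))), ENNReal.rpow_ne_top_of_nonneg (by positivity) hC,
    fun V g hV hg => ?_⟩
  refine lintegral_rpow_le_of_forall_lintegral_mul_le hconj
    (measurable_coextension n a (g := fun x => V x * g x) (hV.mul hg)) fun H hH => ?_
  -- Since 1 + e = n/(n-1), the last two terms add up to (n-1)/n. This is what forces the potential
  -- to be in L^n.
  have hexp : 1 / (n : ℝ) + 1 / (t * (1 + e)) + 1 / (t' * (1 + e)) = 1 := by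
    have h1 : 1 / (t * (1 + e)) + 1 / (t' * (1 + e)) = (t⁻¹ + t'⁻¹) * (1 + e)⁻¹ := by
      rw [one_div, one_div, mul_inv, mul_inv]; ring
    rw [add_assoc, h1, hconj.inv_add_inv_eq_one, he]
    field_simp
    ring
  rw [lintegral_coextension_mul (g := fun x => V x * g x) (hV.mul hg) hH]
  refine (lintegral_mul_mul_le hV hg (measurable_extension n a hH) (by positivity) (by positivity)
    (by positivity) hexp).trans ?_
  calc _ ≤ (∫⁻ x in halfSpace n, V x ^ (n : ℝ)) ^ (1 / (n : ℝ)) *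
        (∫⁻ x in halfSpace n, g x ^ (t * (1 + e))) ^ (1 / (t * (1 + e))) *
        (C * (∫⁻ y, H y ^ t') ^ (1 + e)) ^ (1 / (t' * (1 + e))) := by
        gcongr
        exact hbd H hH
    _ = _ := by
        rw [ENNReal.mul_rpow_of_nonneg _ _ (by positivity), ← ENNReal.rpow_mul (∫⁻ y, H y ^ t')]
        have : (1 + e) * (1 / (t' * (1 + e))) = 1 / t' := by
          field_simp
        rw [this]
        ring

/-! ### Jensen's inequality and regularity lifting. -/

/-- Jensen's inequality for the extension operator. -/
theorem extension_rpow_le {n : ℕ} (hn : 2 ≤ n) {a : ℝ} (ha : a < 1) {w : Bdry n → ℝ≥0∞}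
    (hw : Measurable w) {r : ℝ} (hr : 1 < r) {x : Bdry n × ℝ} (hx : 0 < x.2) :
    extension n a w x ^ r ≤ extension n a (fun y => w y ^ r) x := by
  have hconj := Real.HolderConjugate.conjExponent hr
  set r' := r.conjExponent
  -- The kernel is split as P^{1/r'} P^{1/r}; the first factor has norm one because the kernel has
  -- mass one.
  have h := ENNReal.lintegral_mul_le_Lp_mul_Lq (volume : Measure (Bdry n)) hconj.symm
    (f := fun y => ekernel n a y x ^ (1 / r')) (g := fun y => ekernel n a y x ^ (1 / r) * w y)
    (((measurable_ekernel_right n a x).pow_const _).aemeasurable)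
    ((((measurable_ekernel_right n a x).pow_const _).mul hw).aemeasurable)
  have h1 : ∀ y, ekernel n a y x ^ (1 / r') * (ekernel n a y x ^ (1 / r) * w y) =
      ekernel n a y x * w y := by
    intro y
    rw [← mul_assoc, ← ENNReal.rpow_add_of_nonneg _ _ (one_div_nonneg.2 hconj.symm.nonneg)
      (one_div_nonneg.2 hconj.nonneg), one_div, one_div, hconj.symm.inv_add_inv_eq_one,
      ENNReal.rpow_one]
  have h2 : ∀ y, (ekernel n a y x ^ (1 / r')) ^ r' = ekernel n a y x := by
    intro y
    rw [← ENNReal.rpow_mul, one_div_mul_cancel hconj.symm.pos.ne', ENNReal.rpow_one]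
  have h3 : ∀ y, (ekernel n a y x ^ (1 / r) * w y) ^ r = ekernel n a y x * w y ^ r := by
    intro y
    rw [ENNReal.mul_rpow_of_nonneg _ _ hconj.nonneg, ← ENNReal.rpow_mul,
      one_div_mul_cancel hconj.pos.ne', ENNReal.rpow_one]
  simp only [Pi.mul_apply, h1, h2, h3, lintegral_ekernel hn ha hx, ENNReal.one_rpow, one_mul] at h
  rw [one_div] at h
  exact (ENNReal.le_rpow_inv_iff hconj.pos).1 h

/-- Regularity lifting: if `T` is a contraction on `L^s` and on `L^t`, then a solution of
`W ≤ T W + h` in `L^s` with `h ∈ L^t` belongs to `L^t`. -/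
theorem lintegral_rpow_ne_top_of_le_contraction {α : Type*} [MeasurableSpace α] {μ : Measure α}
    (T : (α → ℝ≥0∞) → α → ℝ≥0∞) (hT : ∀ f, Measurable f → Measurable (T f))
    (hmono : ∀ f g, f ≤ᵐ[μ] g → ∀ x, T f x ≤ T g x)
    (hadd : ∀ f g, Measurable f → ∀ x, T (f + g) x ≤ T f x + T g x)
    {s t : ℝ} (hs : 1 ≤ s) (ht : 1 ≤ t)
    (hTs : ∀ f, Measurable f → ∫⁻ x, T f x ^ s ∂μ ≤ 2⁻¹ ^ s * ∫⁻ x, f x ^ s ∂μ)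
    (hTt : ∀ f, Measurable f → ∫⁻ x, T f x ^ t ∂μ ≤ 2⁻¹ ^ t * ∫⁻ x, f x ^ t ∂μ)
    {W h : α → ℝ≥0∞} (hW : Measurable W) (hh : Measurable h)
    (hWs : ∫⁻ x, W x ^ s ∂μ ≠ ⊤) (hht : ∫⁻ x, h x ^ t ∂μ ≠ ⊤)
    (hle : ∀ᵐ x ∂μ, W x ≤ T W x + h x) : ∫⁻ x, W x ^ t ∂μ ≠ ⊤ := by
  have hs0 : 0 < s := by linarith
  have ht0 : 0 < t := by linarith
  -- Iterates of f ↦ h + T f started at h. They increase, stay bounded in L^t, and catch up with W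
  -- in L^s.
  let S : ℕ → α → ℝ≥0∞ := fun k => Nat.rec h (fun _ f => h + T f) k
  have hS0 : S 0 = h := rfl
  have hSs : ∀ k, S (k + 1) = h + T (S k) := fun k => rfl
  have hSm : ∀ k, Measurable (S k) := by
    intro k
    induction k with
    | zero => exact hh
    | succ k ih => rw [hSs]; exact hh.add (hT _ ih)
  have hSmono : Monotone S := by
    refine monotone_nat_of_le_succ fun k => ?_
    induction k with
    | zero => rw [hSs, hS0]; exact le_self_add
    | succ k ih =>
      rw [hSs (k + 1), hSs k]
      exact add_le_add le_rfl fun x => hmono _ _ (Eventually.of_forall ih) x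
  -- Truncated subtraction keeps only the excess of W over the iterate. Monotonicity and
  -- subadditivity give W - S_{k+1} ≤ T(W - S_k), so each step gains the factor 1/2 in L^s.
  have hdecay : ∀ k, ∫⁻ x, (W x - S k x) ^ s ∂μ ≤ (2⁻¹ ^ s) ^ k * ∫⁻ x, W x ^ s ∂μ := by
    intro k
    induction k with
    | zero =>
      simp only [pow_zero, one_mul]
      exact lintegral_mono fun x => by gcongr; exact tsub_le_self
    | succ k ih =>
      have hD : Measurable fun x => W x - S k x := hW.sub (hSm k)
      calc ∫⁻ x, (W x - S (k + 1) x) ^ s ∂μ ≤ ∫⁻ x, T (fun x => W x - S k x) x ^ s ∂μ := by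
            refine lintegral_mono_ae (hle.mono fun x hx => ?_)
            gcongr
            rw [tsub_le_iff_right, hSs]
            have h1 : T W x ≤ T (fun x => W x - S k x) x + T (S k) x := by
              refine le_trans (hmono W ((fun x => W x - S k x) + S k) ?_ x) (hadd _ _ hD x)
              exact Eventually.of_forall fun x => le_tsub_add
            calc W x ≤ T W x + h x := hx
              _ ≤ T (fun x => W x - S k x) x + T (S k) x + h x := by gcongr
              _ = _ := by simp only [Pi.add_apply]; ring
        _ ≤ 2⁻¹ ^ s * ∫⁻ x, (W x - S k x) ^ s ∂μ := hTs _ hD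
        _ ≤ 2⁻¹ ^ s * ((2⁻¹ ^ s) ^ k * ∫⁻ x, W x ^ s ∂μ) := by gcongr
        _ = _ := by rw [pow_succ]; ring
  -- The bound 2‖h‖ reproduces itself: ‖h‖ + ½ · 2‖h‖ = 2‖h‖.
  have hSbd : ∀ k, (∫⁻ x, S k x ^ t ∂μ) ^ (1 / t) ≤ 2 * (∫⁻ x, h x ^ t ∂μ) ^ (1 / t) := by
    intro k
    induction k with
    | zero => rw [hS0, two_mul]; exact le_self_add
    | succ k ih =>
      rw [hSs]
      refine (ENNReal.lintegral_Lp_add_le hh.aemeasurable (hT _ (hSm k)).aemeasurable ht).trans ?_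
      rw [two_mul]
      refine add_le_add le_rfl ?_
      calc (∫⁻ x, T (S k) x ^ t ∂μ) ^ (1 / t)
          ≤ (2⁻¹ ^ t * ∫⁻ x, S k x ^ t ∂μ) ^ (1 / t) := by gcongr; exact hTt _ (hSm k)
        _ = 2⁻¹ * (∫⁻ x, S k x ^ t ∂μ) ^ (1 / t) := by
            rw [ENNReal.mul_rpow_of_nonneg _ _ (by positivity), ← ENNReal.rpow_mul,
              mul_one_div_cancel ht0.ne', ENNReal.rpow_one]
        _ ≤ 2⁻¹ * (2 * (∫⁻ x, h x ^ t ∂μ) ^ (1 / t)) := by gcongr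
        _ = _ := by
            rw [← mul_assoc, ENNReal.inv_mul_cancel (by simp) (by simp), one_mul]
  set L : α → ℝ≥0∞ := fun x => ⨆ k, S k x with hL
  have hLm : Measurable L := Measurable.iSup hSm
  have hzero : ∫⁻ x, (W x - L x) ^ s ∂μ = 0 := by
    have h1 : ∀ k, ∫⁻ x, (W x - L x) ^ s ∂μ ≤ (2⁻¹ ^ s) ^ k * ∫⁻ x, W x ^ s ∂μ := by
      intro k
      refine le_trans (lintegral_mono fun x => ?_) (hdecay k)
      dsimp only
      gcongr
      exact le_iSup (fun k => S k x) k
    have h2 : Tendsto (fun k : ℕ => ((2⁻¹ : ℝ≥0∞) ^ s) ^ k * ∫⁻ x, W x ^ s ∂μ) atTop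
        (nhds (0 * ∫⁻ x, W x ^ s ∂μ)) := by
      refine ENNReal.Tendsto.mul_const (ENNReal.tendsto_pow_atTop_nhds_zero_of_lt_one ?_)
        (Or.inr hWs)
      exact ENNReal.rpow_lt_one (by simp) hs0
    rw [zero_mul] at h2
    exact le_antisymm (ge_of_tendsto' h2 h1) zero_le
  have hWL : ∀ᵐ x ∂μ, W x ≤ L x := by
    have := (lintegral_eq_zero_iff (by fun_prop)).1 hzero
    refine this.mono fun x hx => ?_
    simpa [ENNReal.rpow_eq_zero_iff, hs0, hs0.not_gt, tsub_eq_zero_iff_le] using hx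
  have hlim := lintegral_tendsto_of_tendsto_of_monotone (μ := μ) (f := fun j x => S j x ^ t)
    (F := fun x => L x ^ t) (fun j => by have := hSm j; fun_prop)
    (Eventually.of_forall fun x i j hij => by
      dsimp only; gcongr; exact hSmono hij x)
    (Eventually.of_forall fun x =>
      (ENNReal.continuous_rpow_const.tendsto (L x)).comp
        (tendsto_atTop_iSup fun i j hij => hSmono hij x))
  have hLt : ∫⁻ x, L x ^ t ∂μ ≤ (2 * (∫⁻ x, h x ^ t ∂μ) ^ (1 / t)) ^ t := by
    refine le_of_tendsto' hlim fun k => ?_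
    have := hSbd k
    rw [one_div] at this ⊢
    exact (ENNReal.rpow_inv_le_iff ht0).1 this
  refine ne_top_of_le_ne_top ?_ ((lintegral_mono_ae (hWL.mono fun x hx => ?_)).trans hLt)
  · refine ENNReal.rpow_ne_top_of_nonneg ht0.le (ENNReal.mul_ne_top (by simp) ?_)
    exact ENNReal.rpow_ne_top_of_nonneg (by positivity) hht
  · gcongr


/-! ### Moving a cutoff through the two operators. -/

theorem rpow_div_rpow_le {θ s r r' R L : ℝ} (hθ : 0 ≤ θ) (hs : 0 ≤ s) (hsR : s ≤ R) (hr : 0 < r)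
    (hr' : 0 < r') (hL : 0 ≤ L) (hsr : s ≤ 2 * r) (hrr' : r' ≤ r + L) :
    s ^ θ / r ^ θ ≤ (R + 2 * L) ^ θ / r' ^ θ := by
  have h : s * r' ≤ (R + 2 * L) * r := by
    nlinarith [mul_le_mul_of_nonneg_left hrr' hs, mul_le_mul_of_nonneg_right hsR hr.le,
      mul_le_mul_of_nonneg_right hsr hL]
  rw [div_le_div_iff₀ (by positivity) (by positivity), ← Real.mul_rpow hs hr'.le,
    ← Real.mul_rpow (by linarith) hr.le]
  exact Real.rpow_le_rpow (by positivity) h hθ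

/-- Here s and s' are the cutoff at y and at x. If s ≤ 2s', the cutoff simply moves over. Otherwise
x is at distance at least s/2 from y, so s^{n-a} compensates the singularity and the kernel is
controlled by the one at a fixed z. The exponent m may exceed n-a because the nonlinear inequality
is multiplied by higher powers of the cutoff. -/
theorem rpow_mul_kernel_le_of_boundary {n : ℕ} (hn : 2 ≤ n) {a : ℝ} (ha : a < 1)
    {y z : Bdry n} {x : Bdry n × ℝ} (hx : 0 < x.2) {s s' R L m : ℝ} (hs : 0 ≤ s) (hs' : 0 ≤ s')
    (hsR : s ≤ R) (hle : s ≤ s' + rad y x) (hL : ‖y - z‖ ≤ L) (hm : (n : ℝ) - a ≤ m) :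
    s ^ m * kernel n a y x ≤ 2 ^ m * s' ^ m * kernel n a y x +
      R ^ (m - (n - a)) * (R + 2 * L) ^ ((n : ℝ) - a) * kernel n a z x := by
  have hn' : (2 : ℝ) ≤ n := by exact_mod_cast hn
  have hL0 : 0 ≤ L := (norm_nonneg _).trans hL
  have hR0 : 0 ≤ R := hs.trans hsR
  have hy := (kernel_pos hn ha y hx).le
  have hz := (kernel_pos hn ha z hx).le
  have hc := (normConst_pos n (by omega) a ha).le
  rcases le_total s (2 * s') with h | h
  · have h1 : s ^ m ≤ 2 ^ m * s' ^ m := by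
      rw [← Real.mul_rpow zero_le_two hs']
      exact Real.rpow_le_rpow hs h (by linarith)
    have h2 : 0 ≤ R ^ (m - (n - a)) * (R + 2 * L) ^ ((n : ℝ) - a) * kernel n a z x := by positivity
    nlinarith [mul_le_mul_of_nonneg_right h1 hy]
  · have h1 := rpow_div_rpow_le (θ := (n : ℝ) - a) (by linarith) hs hsR (rad_pos y hx)
      (rad_pos z hx) hL0 (by linarith) ((rad_le_add z y x).trans (by rw [rad_zero]; linarith))
    have h2 : s ^ m ≤ R ^ (m - (n - a)) * s ^ ((n : ℝ) - a) := by
      have : s ^ m = s ^ (m - (n - a)) * s ^ ((n : ℝ) - a) := by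
        rw [← Real.rpow_add_of_nonneg hs (by linarith) (by linarith)]
        congr 1; ring
      rw [this]
      gcongr
    have h3 : 0 ≤ 2 ^ m * s' ^ m * kernel n a y x := by positivity
    have hx1 : 0 ≤ x.2 ^ (1 - a) := by positivity
    calc s ^ m * kernel n a y x
        ≤ R ^ (m - (n - a)) * s ^ ((n : ℝ) - a) * kernel n a y x := by gcongr
      _ = R ^ (m - (n - a)) * (normConst n a * x.2 ^ (1 - a)) *
          (s ^ ((n : ℝ) - a) / rad y x ^ ((n : ℝ) - a)) := by rw [kernel_eq]; ring
      _ ≤ R ^ (m - (n - a)) * (normConst n a * x.2 ^ (1 - a)) *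
          ((R + 2 * L) ^ ((n : ℝ) - a) / rad z x ^ ((n : ℝ) - a)) := by gcongr
      _ = R ^ (m - (n - a)) * (R + 2 * L) ^ ((n : ℝ) - a) * kernel n a z x := by
          rw [kernel_eq]; ring
      _ ≤ _ := by linarith

/-- The same dichotomy with y fixed and the interior point moved. The numerators x_n^{1-a} now
differ, which costs the factor (R / z_n)^{1-a}. -/
theorem rpow_mul_kernel_le_of_interior {n : ℕ} (hn : 2 ≤ n) {a : ℝ} (ha : a < 1)
    {y : Bdry n} {x z : Bdry n × ℝ} (hx : 0 < x.2) (hz : 0 < z.2) {s s' R L : ℝ} (hs : 0 ≤ s)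
    (hs' : 0 ≤ s') (hsR : s ≤ R) (hle : s ≤ s' + rad y x) (hL0 : 0 ≤ L)
    (hL : rad y z ≤ rad y x + L) (hxR : x.2 ≤ R) :
    s ^ ((n : ℝ) - a) * kernel n a y x ≤ 2 ^ ((n : ℝ) - a) * s' ^ ((n : ℝ) - a) * kernel n a y x +
      (R + 2 * L) ^ ((n : ℝ) - a) * (R / z.2) ^ (1 - a) * kernel n a y z := by
  have hn' : (2 : ℝ) ≤ n := by exact_mod_cast hn
  have hR0 : 0 ≤ R := hs.trans hsR
  have hy := (kernel_pos hn ha y hx).le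
  have hkz := (kernel_pos hn ha y hz).le
  have hc := (normConst_pos n (by omega) a ha).le
  rcases le_total s (2 * s') with h | h
  · have h1 : s ^ ((n : ℝ) - a) ≤ 2 ^ ((n : ℝ) - a) * s' ^ ((n : ℝ) - a) := by
      rw [← Real.mul_rpow zero_le_two hs']
      exact Real.rpow_le_rpow hs h (by linarith)
    have h2 : 0 ≤ (R + 2 * L) ^ ((n : ℝ) - a) * (R / z.2) ^ (1 - a) * kernel n a y z := by
      positivity
    nlinarith [mul_le_mul_of_nonneg_right h1 hy]
  · have h1 := rpow_div_rpow_le (θ := (n : ℝ) - a) (by linarith) hs hsR (rad_pos y hx)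
      (rad_pos y hz) hL0 (by linarith) hL
    have h3 : 0 ≤ 2 ^ ((n : ℝ) - a) * s' ^ ((n : ℝ) - a) * kernel n a y x := by positivity
    have hx1 : x.2 ^ (1 - a) ≤ R ^ (1 - a) := Real.rpow_le_rpow hx.le hxR (by linarith)
    have hz1 : 0 < z.2 ^ (1 - a) := by positivity
    have hrz := rad_pos y hz
    calc s ^ ((n : ℝ) - a) * kernel n a y x
        = normConst n a * x.2 ^ (1 - a) *
          (s ^ ((n : ℝ) - a) / rad y x ^ ((n : ℝ) - a)) := by rw [kernel_eq]; ring
      _ ≤ normConst n a * R ^ (1 - a) *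
          ((R + 2 * L) ^ ((n : ℝ) - a) / rad y z ^ ((n : ℝ) - a)) := by
          have := rad_nonneg y x
          gcongr
      _ = (R + 2 * L) ^ ((n : ℝ) - a) * (R / z.2) ^ (1 - a) * kernel n a y z := by
          rw [kernel_eq, Real.div_rpow hR0 hz.le]
          field_simp
      _ ≤ _ := by linarith

/-- The cutoff function `(ρ - |x - (y₀, 0)|)₊`. -/
noncomputable def cutoff {n : ℕ} (ρ : ℝ) (y₀ : Bdry n) (x : Bdry n × ℝ) : ℝ≥0∞ :=
  ENNReal.ofReal (ρ - rad y₀ x)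

@[fun_prop]
theorem measurable_cutoff {n : ℕ} (ρ : ℝ) (y₀ : Bdry n) : Measurable (cutoff ρ y₀) := by
  unfold cutoff rad
  fun_prop

theorem cutoff_le {n : ℕ} (ρ : ℝ) (y₀ : Bdry n) (x : Bdry n × ℝ) :
    cutoff ρ y₀ x ≤ ENNReal.ofReal ρ :=
  ENNReal.ofReal_le_ofReal (by linarith [rad_nonneg y₀ x])

theorem cutoff_eq_zero_iff {n : ℕ} {ρ : ℝ} {y₀ : Bdry n} {x : Bdry n × ℝ} :
    cutoff ρ y₀ x = 0 ↔ ρ ≤ rad y₀ x := by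
  rw [cutoff, ENNReal.ofReal_eq_zero, sub_nonpos]

theorem rad_boundary_le {n : ℕ} (y z : Bdry n) (x : Bdry n × ℝ) :
    rad y (z, 0) ≤ rad y x + rad z x := by
  simp only [rad_eq_dist]
  rw [dist_comm (WithLp.toLp 2 (z, (0 : ℝ))), dist_comm (WithLp.toLp 2 x)]
  exact dist_triangle _ _ _

/-- Moving the cutoff through the extension operator. -/
theorem exists_cutoff_mul_extension_le {n : ℕ} (hn : 2 ≤ n) {a : ℝ} (ha : a < 1) (ρ : ℝ)
    (y₀ : Bdry n) {w : Bdry n → ℝ≥0∞} (hw : Measurable w) {z : Bdry n × ℝ} (hz : 0 < z.2)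
    (hfin : extension n a w z ≠ ⊤) :
    ∃ C : ℝ≥0∞, C ≠ ⊤ ∧ ∀ x : Bdry n × ℝ, 0 < x.2 →
      cutoff ρ y₀ x ^ ((n : ℝ) - a) * extension n a w x ≤
        2 ^ ((n : ℝ) - a) * extension n a (fun y => cutoff ρ y₀ (y, 0) ^ ((n : ℝ) - a) * w y) x
          + C := by
  have hn' : (2 : ℝ) ≤ n := by exact_mod_cast hn
  have hθ : 0 < (n : ℝ) - a := by linarith
  set L := ρ + rad y₀ z with hL
  set C := (ρ + 2 * L) ^ ((n : ℝ) - a) * (ρ / z.2) ^ (1 - a) with hC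
  refine ⟨ENNReal.ofReal C * extension n a w z, ENNReal.mul_ne_top ENNReal.ofReal_ne_top hfin,
    fun x hx => ?_⟩
  by_cases h0 : ρ ≤ rad y₀ x
  · rw [cutoff_eq_zero_iff.2 h0, ENNReal.zero_rpow_of_pos hθ, zero_mul]
    exact zero_le
  have h0 : rad y₀ x < ρ := not_le.1 h0
  have hρ : 0 ≤ ρ := (rad_nonneg y₀ x).trans h0.le
  have hL0 : 0 ≤ L := add_nonneg hρ (rad_nonneg _ _)
  have hCpos : 0 ≤ C := by positivity
  have hpt : ∀ y, cutoff ρ y₀ x ^ ((n : ℝ) - a) * ekernel n a y x ≤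
      2 ^ ((n : ℝ) - a) * cutoff ρ y₀ (y, 0) ^ ((n : ℝ) - a) * ekernel n a y x +
        ENNReal.ofReal C * ekernel n a y z := by
    intro y
    have hk := (kernel_pos hn ha y hx).le
    have hkz := (kernel_pos hn ha y hz).le
    have h1 := rpow_mul_kernel_le_of_interior hn ha (y := y) hx hz (s := ρ - rad y₀ x)
      (s' := max (ρ - rad y₀ (y, 0)) 0) (R := ρ) (L := L) (by linarith) (le_max_right _ _)
      (by linarith [rad_nonneg y₀ x])
      (by linarith [le_max_left (ρ - rad y₀ (y, 0)) 0, rad_boundary_le y₀ y x]) hL0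
      (by
        have e1 := rad_le_add y y₀ z
        have e2 := rad_boundary_le y y₀ x
        linarith)
      ((height_le_rad y₀ x).trans h0.le)
    have h2 := ENNReal.ofReal_le_ofReal h1
    rw [ENNReal.ofReal_add (by positivity) (by positivity),
      ENNReal.ofReal_mul (Real.rpow_nonneg (by linarith) _),
      ENNReal.ofReal_mul (by positivity), ENNReal.ofReal_mul (by positivity), ← hC,
      ENNReal.ofReal_mul hCpos,
      ← ENNReal.ofReal_rpow_of_nonneg (by linarith) hθ.le,
      ← ENNReal.ofReal_rpow_of_nonneg (le_max_right _ _) hθ.le,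
      ← ENNReal.ofReal_rpow_of_nonneg zero_le_two hθ.le, ENNReal.ofReal_max] at h2
    simpa [cutoff] using h2
  calc cutoff ρ y₀ x ^ ((n : ℝ) - a) * extension n a w x
      = ∫⁻ y, cutoff ρ y₀ x ^ ((n : ℝ) - a) * ekernel n a y x * w y := by
        rw [extension, ← lintegral_const_mul _ (by fun_prop)]
        exact lintegral_congr fun y => (mul_assoc _ _ _).symm
    _ ≤ ∫⁻ y, (2 ^ ((n : ℝ) - a) *
          (ekernel n a y x * (cutoff ρ y₀ (y, 0) ^ ((n : ℝ) - a) * w y)) +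
        ENNReal.ofReal C * (ekernel n a y z * w y)) := by
        refine lintegral_mono fun y => ?_
        refine (mul_le_mul_left (hpt y) _).trans (le_of_eq ?_)
        ring
    _ = _ := by
        rw [lintegral_add_right _ (by fun_prop), lintegral_const_mul _ (by fun_prop),
          lintegral_const_mul _ (by fun_prop)]
        rfl

/-- Moving the cutoff through the coextension operator. -/
theorem exists_cutoff_mul_coextension_le {n : ℕ} (hn : 2 ≤ n) {a : ℝ} (ha : a < 1) (ρ : ℝ)
    (y₀ : Bdry n) {g : Bdry n × ℝ → ℝ≥0∞} (hg : Measurable g) {z : Bdry n}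
    (hfin : coextension n a g z ≠ ⊤) {m : ℝ} (hm : (n : ℝ) - a ≤ m) :
    ∃ C : ℝ≥0∞, C ≠ ⊤ ∧ ∀ y : Bdry n,
      cutoff ρ y₀ (y, 0) ^ m * coextension n a g y ≤
        2 ^ m * coextension n a (fun x => cutoff ρ y₀ x ^ m * g x) y + C := by
  have hn' : (2 : ℝ) ≤ n := by exact_mod_cast hn
  have hm0 : 0 < m := by linarith
  set L := ρ + rad y₀ (z, 0) with hL
  set C := ρ ^ (m - (n - a)) * (ρ + 2 * L) ^ ((n : ℝ) - a) with hC
  refine ⟨ENNReal.ofReal C * coextension n a g z, ENNReal.mul_ne_top ENNReal.ofReal_ne_top hfin,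
    fun y => ?_⟩
  by_cases h0 : ρ ≤ rad y₀ (y, 0)
  · rw [cutoff_eq_zero_iff.2 h0, ENNReal.zero_rpow_of_pos hm0, zero_mul]
    exact zero_le
  have h0 : rad y₀ (y, 0) < ρ := not_le.1 h0
  have hρ : 0 ≤ ρ := (rad_nonneg y₀ _).trans h0.le
  have hL0 : 0 ≤ L := add_nonneg hρ (rad_nonneg _ _)
  have hCpos : 0 ≤ C := by positivity
  have hyz : ‖y - z‖ ≤ L := by
    have h1 : ‖y - z‖ ≤ ‖y - y₀‖ + ‖z - y₀‖ := by
      rw [norm_sub_rev z]; exact norm_sub_le_norm_sub_add_norm_sub _ _ _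
    rw [rad_zero] at h0
    rw [hL, rad_zero]
    linarith
  have hpt : ∀ x ∈ halfSpace n, cutoff ρ y₀ (y, 0) ^ m * ekernel n a y x ≤
      2 ^ m * cutoff ρ y₀ x ^ m * ekernel n a y x + ENNReal.ofReal C * ekernel n a z x := by
    intro x hx
    have hx : 0 < x.2 := hx
    have hk := (kernel_pos hn ha y hx).le
    have hkz := (kernel_pos hn ha z hx).le
    have h1 := rpow_mul_kernel_le_of_boundary hn ha (y := y) (z := z) hx
      (s := ρ - rad y₀ (y, 0)) (s' := max (ρ - rad y₀ x) 0) (R := ρ) (L := L) (by linarith)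
      (le_max_right _ _) (by linarith [rad_nonneg y₀ (y, 0)])
      (by linarith [le_max_left (ρ - rad y₀ x) 0, rad_le_add y₀ y x]) hyz hm
    have h2 := ENNReal.ofReal_le_ofReal h1
    rw [ENNReal.ofReal_add (by positivity) (by positivity),
      ENNReal.ofReal_mul (Real.rpow_nonneg (by linarith) _),
      ENNReal.ofReal_mul (by positivity), ENNReal.ofReal_mul (by positivity), ← hC,
      ENNReal.ofReal_mul hCpos,
      ← ENNReal.ofReal_rpow_of_nonneg (by linarith) hm0.le,
      ← ENNReal.ofReal_rpow_of_nonneg (le_max_right _ _) hm0.le,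
      ← ENNReal.ofReal_rpow_of_nonneg zero_le_two hm0.le, ENNReal.ofReal_max] at h2
    simpa [cutoff] using h2
  calc cutoff ρ y₀ (y, 0) ^ m * coextension n a g y
      = ∫⁻ x in halfSpace n, cutoff ρ y₀ (y, 0) ^ m * ekernel n a y x * g x := by
        rw [coextension, ← lintegral_const_mul _ (by fun_prop)]
        exact lintegral_congr fun x => (mul_assoc _ _ _).symm
    _ ≤ ∫⁻ x in halfSpace n, (2 ^ m * (ekernel n a y x * (cutoff ρ y₀ x ^ m * g x)) +
        ENNReal.ofReal C * (ekernel n a z x * g x)) := by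
        refine setLIntegral_mono' (measurableSet_halfSpace n) fun x hx => ?_
        refine (mul_le_mul_left (hpt x hx) _).trans (le_of_eq ?_)
        ring
    _ = _ := by
        rw [lintegral_add_right _ (by fun_prop), lintegral_const_mul _ (by fun_prop),
          lintegral_const_mul _ (by fun_prop)]
        rfl

/-! ### The composed operator and a uniform bound for the adjoint. -/

/-- The composition `w ↦ coextension (V * extension w)` is bounded on `L^t` by `‖V‖_n`. -/
theorem exists_lintegral_coextension_mul_extension_le {n : ℕ} (hn : 2 ≤ n) {a : ℝ} (ha : a < 1)
    {t : ℝ} (ht : 1 < t) : ∃ C : ℝ≥0∞, C ≠ ⊤ ∧ ∀ (V : Bdry n × ℝ → ℝ≥0∞) (w : Bdry n → ℝ≥0∞),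
      Measurable V → Measurable w →
      ∫⁻ y, coextension n a (fun x => V x * extension n a w x) y ^ t ≤
        (C * (∫⁻ x in halfSpace n, V x ^ (n : ℝ)) ^ (1 / (n : ℝ))) ^ t * ∫⁻ y, w y ^ t := by
  have hn' : (2 : ℝ) ≤ n := by exact_mod_cast hn
  have hd : 0 < (n : ℝ) - 1 := by linarith
  obtain ⟨C₁, hC₁, h₁⟩ := exists_lintegral_extension_rpow_le hn ha ht
  obtain ⟨C₂, hC₂, h₂⟩ := exists_lintegral_coextension_rpow_le hn ha ht
  set e := 1 / ((n : ℝ) - 1) with he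
  have he0 : 0 < e := by positivity
  refine ⟨C₂ * C₁ ^ (1 / (t * (1 + e))), ENNReal.mul_ne_top hC₂
    (ENNReal.rpow_ne_top_of_nonneg (by positivity) hC₁), fun V w hV hw => ?_⟩
  refine (h₂ V _ hV (measurable_extension n a hw)).trans ?_
  set N := (∫⁻ x in halfSpace n, V x ^ (n : ℝ)) ^ (1 / (n : ℝ))
  calc _ ≤ (C₂ * N * (C₁ * (∫⁻ y, w y ^ t) ^ (1 + e)) ^ (1 / (t * (1 + e)))) ^ t := by
        gcongr
        exact h₁ w hw
    _ = (C₂ * C₁ ^ (1 / (t * (1 + e))) * N * (∫⁻ y, w y ^ t) ^ (1 / t)) ^ t := by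
        have : (1 + e) * (1 / (t * (1 + e))) = 1 / t := by field_simp
        rw [ENNReal.mul_rpow_of_nonneg C₁ _ (by positivity), ← ENNReal.rpow_mul (∫⁻ y, w y ^ t),
          this]
        congr 1
        ring
    _ = _ := by
        rw [ENNReal.mul_rpow_of_nonneg _ _ (by positivity), ← ENNReal.rpow_mul (∫⁻ y, w y ^ t),
          one_div_mul_cancel (by positivity), ENNReal.rpow_one]

/-- Each slice contributes mass one, which leaves the integral of t^{-σ} over (0, R). -/
theorem lintegral_ekernel_mul_height_le {n : ℕ} (hn : 2 ≤ n) {a : ℝ} (ha : a < 1) {σ : ℝ}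
    (hσ : σ < 1) {R : ℝ} (hR : 0 ≤ R) (y : Bdry n) :
    ∫⁻ x in halfSpace n, {x : Bdry n × ℝ | x.2 < R}.indicator
      (fun x => ekernel n a y x * ENNReal.ofReal (x.2 ^ (-σ))) x ≤
      ENNReal.ofReal (R ^ (1 - σ) / (1 - σ)) := by
  have hm : Measurable (fun x : Bdry n × ℝ => ekernel n a y x * ENNReal.ofReal (x.2 ^ (-σ))) := by
    fun_prop
  rw [setLIntegral_halfSpace (hm.indicator (measurableSet_lt measurable_snd measurable_const)),
    ← lintegral_Ioo_rpow (by linarith) hR, ← Set.Ioi_inter_Iio, Set.inter_comm,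
    ← Measure.restrict_restrict measurableSet_Iio, ← lintegral_indicator measurableSet_Iio]
  refine setLIntegral_mono' measurableSet_Ioi fun t ht => ?_
  by_cases htR : t < R
  · have hmk : Measurable (fun z => ekernel n a y (z, t)) :=
      (measurable_ekernel_left n a y).comp (by fun_prop)
    simp only [Set.indicator, Set.mem_ofPred_eq, Set.mem_Iio, htR, if_true]
    rw [lintegral_mul_const _ hmk, lintegral_ekernel_slice hn ha y ht, one_mul]
    refine le_of_eq ?_
    congr 2; ring
  · simp [Set.indicator, htR]

/-- `coextension` is bounded on functions in `L^{2n}` supported in a strip. -/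
theorem exists_coextension_le_of_lintegral_rpow {n : ℕ} (hn : 2 ≤ n) {a : ℝ} (ha : a < 1)
    {g : Bdry n × ℝ → ℝ≥0∞} (hg : Measurable g) {R : ℝ} (hR : 0 ≤ R)
    (hsupp : ∀ x : Bdry n × ℝ, R ≤ x.2 → g x = 0)
    (hfin : ∫⁻ x in halfSpace n, g x ^ (2 * (n : ℝ)) ≠ ⊤) :
    ∃ C : ℝ≥0∞, C ≠ ⊤ ∧ ∀ y, coextension n a g y ≤ C := by
  have hn' : (2 : ℝ) ≤ n := by exact_mod_cast hn
  have hc := normConst_pos n (by omega) a ha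
  have hconj := (Real.HolderConjugate.conjExponent (p := 2 * (n : ℝ)) (by linarith)).symm
  set s := (2 * (n : ℝ)).conjExponent with hs
  have hs1 : s - 1 = 1 / (2 * n - 1) := by
    rw [hs, Real.conjExponent]
    have : (2 * (n : ℝ) - 1) ≠ 0 := by linarith
    field_simp
    ring
  -- By the height bound, P^s ≤ c^{s-1} P x_n^{-σ}. For the exponent s dual to 2n this gives σ =
  -- (n-1)/(2n-1) < 1, hence an integral over the strip that is finite uniformly in y.
  set σ := ((n : ℝ) - 1) * (s - 1) with hσ
  have hσ1 : σ < 1 := by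
    rw [hσ, hs1, mul_one_div, div_lt_one (by linarith)]
    linarith
  set D := ENNReal.ofReal (normConst n a ^ (s - 1)) * ENNReal.ofReal (R ^ (1 - σ) / (1 - σ))
  refine ⟨D ^ (1 / s) * (∫⁻ x in halfSpace n, g x ^ (2 * (n : ℝ))) ^ (1 / (2 * (n : ℝ))), ?_,
    fun y => ?_⟩
  · refine ENNReal.mul_ne_top (ENNReal.rpow_ne_top_of_nonneg (one_div_nonneg.2 hconj.nonneg)
      (ENNReal.mul_ne_top ENNReal.ofReal_ne_top ENNReal.ofReal_ne_top))
      (ENNReal.rpow_ne_top_of_nonneg (by positivity) hfin)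
  set k := {x : Bdry n × ℝ | x.2 < R}.indicator (ekernel n a y) with hk
  have hkm : Measurable k :=
    (measurable_ekernel_left n a y).indicator (measurableSet_lt measurable_snd measurable_const)
  have h1 : coextension n a g y = ∫⁻ x in halfSpace n, (k * g) x := by
    refine lintegral_congr fun x => ?_
    by_cases hx : x.2 < R
    · simp [hk, Set.indicator, hx]
    · simp [hsupp x (not_lt.1 hx)]
  rw [h1]
  refine (ENNReal.lintegral_mul_le_Lp_mul_Lq _ hconj hkm.aemeasurable hg.aemeasurable).trans ?_
  have hs0 : 0 < s := hconj.pos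
  have hs1' : 0 ≤ s - 1 := by have := hconj.lt; linarith
  gcongr
  refine le_trans (setLIntegral_mono' (measurableSet_halfSpace n) (g := fun x =>
    ENNReal.ofReal (normConst n a ^ (s - 1)) * {x : Bdry n × ℝ | x.2 < R}.indicator
      (fun x => ekernel n a y x * ENNReal.ofReal (x.2 ^ (-σ))) x) fun x hx => ?_) ?_
  · have hx : 0 < x.2 := hx
    by_cases hxR : x.2 < R
    · simp only [hk, Set.indicator, Set.mem_ofPred_eq, hxR, if_true]
      have hkp := kernel_pos hn ha y hx
      rw [ENNReal.ofReal_rpow_of_nonneg hkp.le hconj.nonneg, ← ENNReal.ofReal_mul hkp.le,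
        ← ENNReal.ofReal_mul (by positivity)]
      refine ENNReal.ofReal_le_ofReal ?_
      have h2 : kernel n a y x ^ (s - 1) ≤ normConst n a ^ (s - 1) * x.2 ^ (-σ) := by
        refine (Real.rpow_le_rpow hkp.le (kernel_le_height hn ha y hx) hs1').trans (le_of_eq ?_)
        rw [Real.mul_rpow hc.le (by positivity), ← Real.rpow_mul hx.le, hσ]
        congr 2; ring
      calc kernel n a y x ^ s = kernel n a y x * kernel n a y x ^ (s - 1) := by
            nth_rewrite 2 [← Real.rpow_one (kernel n a y x)]
            rw [← Real.rpow_add hkp]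
            congr 1; ring
        _ ≤ kernel n a y x * (normConst n a ^ (s - 1) * x.2 ^ (-σ)) := by gcongr
        _ = _ := by ring
    · simp [hk, Set.indicator, hxR, hs0]
  · rw [lintegral_const_mul]
    · exact mul_le_mul' le_rfl (lintegral_ekernel_mul_height_le hn ha hσ1 hR y)
    · refine Measurable.indicator (by fun_prop) (measurableSet_lt measurable_snd measurable_const)

/-! ### Integrability and smallness on half-balls. -/

/-- A cylinder with a fixed base is enough: only convergence to zero as ρ → 0 is needed, not the
rate. -/
theorem volume_rad_lt_le {n : ℕ} (y₀ : Bdry n) {ρ : ℝ} (hρ : ρ ≤ 1) :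
    volume {x : Bdry n × ℝ | rad y₀ x < ρ} ≤
      volume (Metric.ball y₀ 1) * ENNReal.ofReal (2 * ρ) := by
  have h : {x : Bdry n × ℝ | rad y₀ x < ρ} ⊆ Metric.ball y₀ 1 ×ˢ Set.Ioo (-ρ) ρ := by
    intro x hx
    have hx : rad y₀ x < ρ := hx
    have hsq : ‖x.1 - y₀‖ ^ 2 + x.2 ^ 2 = rad y₀ x ^ 2 := by
      rw [rad, Real.sq_sqrt (by positivity)]
    have h0 := rad_nonneg y₀ x
    refine ⟨?_, abs_lt.1 (lt_of_le_of_lt (abs_le_of_sq_le_sq ?_ h0) hx)⟩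
    · rw [Metric.mem_ball, dist_eq_norm]
      refine lt_of_le_of_lt (abs_le_of_sq_le_sq (a := ‖x.1 - y₀‖) ?_ h0 |> (le_abs_self _).trans)
        (hx.trans_le hρ)
      nlinarith [sq_nonneg x.2]
    · nlinarith [sq_nonneg ‖x.1 - y₀‖]
  refine (measure_mono h).trans (le_of_eq ?_)
  rw [Measure.volume_eq_prod, Measure.prod_prod, Real.volume_Ioo]
  congr 2; ring


theorem rpow_mul_add_le {q : ℝ} (hq : 1 ≤ q) (A g C : ℝ≥0∞) :
    (A * g + C) ^ q ≤ 2 ^ (q - 1) * A ^ q * g ^ q + 2 ^ (q - 1) * C ^ q := by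
  refine (ENNReal.rpow_add_le_mul_rpow_add_rpow _ _ hq).trans (le_of_eq ?_)
  rw [ENNReal.mul_rpow_of_nonneg _ _ (by linarith)]
  ring

theorem lintegral_mul_add_rpow_ne_top {α : Type*} [MeasurableSpace α] {μ : Measure α}
    (hμ : μ Set.univ ≠ ⊤) {g : α → ℝ≥0∞} {q : ℝ} (hq : 1 ≤ q)
    (hfin : ∫⁻ x, g x ^ q ∂μ ≠ ⊤) {A C : ℝ≥0∞} (hA : A ≠ ⊤) (hC : C ≠ ⊤) :
    ∫⁻ x, (A * g x + C) ^ q ∂μ ≠ ⊤ := by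
  have h2 : (2 : ℝ≥0∞) ^ (q - 1) ≠ ⊤ := ENNReal.rpow_ne_top_of_nonneg (by linarith) (by simp)
  have hAq : (2 : ℝ≥0∞) ^ (q - 1) * A ^ q ≠ ⊤ :=
    ENNReal.mul_ne_top h2 (ENNReal.rpow_ne_top_of_nonneg (by linarith) hA)
  have hCq : (2 : ℝ≥0∞) ^ (q - 1) * C ^ q ≠ ⊤ :=
    ENNReal.mul_ne_top h2 (ENNReal.rpow_ne_top_of_nonneg (by linarith) hC)
  refine ne_top_of_le_ne_top ?_ (lintegral_mono fun x => rpow_mul_add_le hq A (g x) C)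
  rw [lintegral_add_right _ measurable_const, lintegral_const_mul' _ _ hAq, lintegral_const]
  exact ENNReal.add_ne_top.2 ⟨ENNReal.mul_ne_top hAq hfin, ENNReal.mul_ne_top hCq hμ⟩

theorem lintegral_cutoff_mul_rpow_ne_top {n : ℕ} {ρ θ t : ℝ} (hθ : 0 < θ) (ht : 0 < t)
    (y₀ : Bdry n) {w : Bdry n → ℝ≥0∞} (hfin : ∫⁻ y in Metric.ball y₀ ρ, w y ^ t ≠ ⊤) :
    ∫⁻ y, (cutoff ρ y₀ (y, 0) ^ θ * w y) ^ t ≠ ⊤ := by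
  have hρ : (ENNReal.ofReal ρ ^ θ) ^ t ≠ ⊤ := ENNReal.rpow_ne_top_of_nonneg ht.le
    (ENNReal.rpow_ne_top_of_nonneg hθ.le ENNReal.ofReal_ne_top)
  refine ne_top_of_le_ne_top (ENNReal.mul_ne_top hρ hfin) ?_
  rw [← lintegral_const_mul' _ _ hρ, ← lintegral_indicator measurableSet_ball]
  refine lintegral_mono fun y => ?_
  by_cases hy : y ∈ Metric.ball y₀ ρ
  · rw [Set.indicator_of_mem hy, ENNReal.mul_rpow_of_nonneg _ _ ht.le]
    gcongr
    exact cutoff_le _ _ _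
  · have h0 : cutoff ρ y₀ (y, 0) = 0 := by
      rw [cutoff_eq_zero_iff, rad_zero]
      simpa [dist_eq_norm] using hy
    simp [h0, hθ, ht]

theorem volume_rad_lt_ne_top {n : ℕ} (y₀ : Bdry n) {ρ : ℝ} (hρ : ρ ≤ 1) :
    volume {x : Bdry n × ℝ | rad y₀ x < ρ} ≠ ⊤ :=
  ne_top_of_le_ne_top (ENNReal.mul_ne_top measure_ball_lt_top.ne ENNReal.ofReal_ne_top)
    (volume_rad_lt_le y₀ hρ)

theorem measurableSet_rad_lt {n : ℕ} (y₀ : Bdry n) (ρ : ℝ) :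
    MeasurableSet {x : Bdry n × ℝ | rad y₀ x < ρ} :=
  measurableSet_lt (by unfold rad; fun_prop) measurable_const

theorem restrict_rad_lt_univ_ne_top {n : ℕ} (y₀ : Bdry n) {ρ : ℝ} (hρ : ρ ≤ 1) :
    ((volume.restrict (halfSpace n)).restrict {x : Bdry n × ℝ | rad y₀ x < ρ}) Set.univ ≠ ⊤ := by
  rw [Measure.restrict_apply_univ]
  exact ne_top_of_le_ne_top (volume_rad_lt_ne_top y₀ hρ) (Measure.restrict_apply_le _ _)

/-- The extension of an `L^{t}_loc` function is in `L^{nt / (n - 1)}` near the boundary. -/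
theorem setLIntegral_extension_rpow_ne_top {n : ℕ} (hn : 2 ≤ n) {a : ℝ} (ha : a < 1) (y₀ : Bdry n)
    {w : Bdry n → ℝ≥0∞} (hw : Measurable w) {z : Bdry n × ℝ} (hz : 0 < z.2)
    (hfin : extension n a w z ≠ ⊤) {t : ℝ} (ht : 1 < t)
    (hLp : ∫⁻ y in Metric.ball y₀ 2, w y ^ t ≠ ⊤) :
    ∫⁻ x in {x | rad y₀ x < 1}, extension n a w x ^ (t * (1 + 1 / ((n : ℝ) - 1)))
      ∂(volume.restrict (halfSpace n)) ≠ ⊤ := by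
  have hn' : (2 : ℝ) ≤ n := by exact_mod_cast hn
  have hd : 0 < (n : ℝ) - 1 := by linarith
  have hθ : 0 < (n : ℝ) - a := by linarith
  obtain ⟨C, hC, hcut⟩ := exists_cutoff_mul_extension_le hn ha 2 y₀ hw hz hfin
  obtain ⟨C₁, hC₁, hstrong⟩ := exists_lintegral_extension_rpow_le hn ha ht
  set q := t * (1 + 1 / ((n : ℝ) - 1)) with hq
  have he : 0 < 1 / ((n : ℝ) - 1) := by positivity
  have hq1 : 1 ≤ q := by nlinarith
  set ω : Bdry n → ℝ≥0∞ := fun y => cutoff 2 y₀ (y, 0) ^ ((n : ℝ) - a) * w y with hω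
  have hωm : Measurable ω := by fun_prop
  have hωt : ∫⁻ y, ω y ^ t ≠ ⊤ := lintegral_cutoff_mul_rpow_ne_top hθ (by linarith) y₀ hLp
  have hext : ∫⁻ x in halfSpace n, extension n a ω x ^ q ≠ ⊤ :=
    ne_top_of_le_ne_top (ENNReal.mul_ne_top hC₁ (ENNReal.rpow_ne_top_of_nonneg (by positivity) hωt))
      (hstrong ω hωm)
  have h2 : (2 : ℝ≥0∞) ^ ((n : ℝ) - a) ≠ ⊤ := ENNReal.rpow_ne_top_of_nonneg hθ.le (by simp)
  refine ne_top_of_le_ne_top (lintegral_mul_add_rpow_ne_top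
    (restrict_rad_lt_univ_ne_top y₀ le_rfl) hq1
    (ne_top_of_le_ne_top hext (setLIntegral_le_lintegral _ _)) h2 hC) ?_
  rw [Measure.restrict_restrict (measurableSet_rad_lt y₀ 1)]
  refine setLIntegral_mono' ((measurableSet_rad_lt y₀ 1).inter (measurableSet_halfSpace n))
    fun x hx => ?_
  have hx1 : rad y₀ x < 1 := hx.1
  have hx2 : 0 < x.2 := hx.2
  -- Radius 2 makes the cutoff at least one on the unit half-ball, so it can be dropped.
  have hcut1 : 1 ≤ cutoff 2 y₀ x := by
    rw [cutoff, ENNReal.one_le_ofReal]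
    linarith
  gcongr
  calc extension n a w x = 1 ^ ((n : ℝ) - a) * extension n a w x := by simp
    _ ≤ cutoff 2 y₀ x ^ ((n : ℝ) - a) * extension n a w x := by gcongr
    _ ≤ _ := hcut x hx2

/-- Absolute continuity of the integral. This is the only source of smallness; no size condition on
the solution enters. -/
theorem tendsto_setLIntegral_rad_lt {n : ℕ} (y₀ : Bdry n) {G : Bdry n × ℝ → ℝ≥0∞}
    (hfin : ∫⁻ x in {x | rad y₀ x < 1}, G x ∂(volume.restrict (halfSpace n)) ≠ ⊤) :
    Tendsto (fun k : ℕ => ∫⁻ x in {x | rad y₀ x < 1 / ((k : ℝ) + 1)}, G x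
      ∂(volume.restrict (halfSpace n))) atTop (nhds 0) := by
  have hle : ∀ k : ℕ, 1 / ((k : ℝ) + 1) ≤ 1 := fun k => by
    rw [div_le_one (by positivity)]; linarith [(Nat.cast_nonneg k : (0 : ℝ) ≤ k)]
  have h1 := tendsto_setLIntegral_zero (μ := (volume.restrict (halfSpace n)).restrict
    {x | rad y₀ x < 1}) hfin (l := atTop) (s := fun k : ℕ => {x | rad y₀ x < 1 / ((k : ℝ) + 1)}) ?_
  · refine h1.congr fun k => ?_
    rw [Measure.restrict_restrict (measurableSet_rad_lt _ _)]
    congr 2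
    ext x
    simp only [Set.mem_inter_iff, Set.mem_ofPred_eq, and_iff_left_iff_imp]
    exact fun hx => hx.trans_le (hle k)
  · have h2 : Tendsto (fun k : ℕ => volume (Metric.ball y₀ 1) *
        ENNReal.ofReal (2 * (1 / ((k : ℝ) + 1)))) atTop (nhds 0) := by
      have h3 : Tendsto (fun k : ℕ => ENNReal.ofReal (2 * (1 / ((k : ℝ) + 1)))) atTop (nhds 0) := by
        rw [← ENNReal.ofReal_zero]
        refine ENNReal.tendsto_ofReal ?_
        simpa using tendsto_one_div_add_atTop_nhds_zero_nat.const_mul (2 : ℝ)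
      simpa using ENNReal.Tendsto.const_mul h3 (Or.inr measure_ball_lt_top.ne)
    refine tendsto_of_tendsto_of_tendsto_of_le_of_le tendsto_const_nhds h2 (fun _ => zero_le)
      fun k => ?_
    exact (Measure.restrict_apply_le _ _).trans ((Measure.restrict_apply_le _ _).trans
      (volume_rad_lt_le y₀ (hle k)))

/-- Pointwise bound which linearizes the equation. -/
theorem cutoff_rpow_mul_rpow_le {n : ℕ} (hn : 2 ≤ n) {a : ℝ} (ha : a < 1) {y₀ : Bdry n} {ρ : ℝ}
    {r δ : ℝ} (hr : 1 < r) (hδ : 0 < δ) {w ω : Bdry n → ℝ≥0∞} (hω : Measurable ω) {C : ℝ≥0∞}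
    {x : Bdry n × ℝ} (hx : 0 < x.2)
    (hcut : cutoff ρ y₀ x ^ ((n : ℝ) - a) * extension n a w x ≤
      2 ^ ((n : ℝ) - a) * extension n a ω x + C) :
    cutoff ρ y₀ x ^ (((n : ℝ) - a) * r) * extension n a w x ^ (r + δ) ≤
      2 ^ (r - 1) * (2 ^ ((n : ℝ) - a)) ^ r *
        ({x | rad y₀ x < ρ}.indicator (fun x => extension n a w x ^ δ) x *
          extension n a (fun y => ω y ^ r) x) +
      2 ^ (r - 1) * C ^ r * ({x | rad y₀ x < ρ}.indicator (fun x => extension n a w x ^ δ) x *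
        {x | rad y₀ x < ρ}.indicator 1 x) := by
  have hn' : (2 : ℝ) ≤ n := by exact_mod_cast hn
  have hθ : 0 < (n : ℝ) - a := by linarith
  by_cases h : rad y₀ x < ρ
  · simp only [Set.indicator, Set.mem_ofPred_eq, h, if_true, Pi.one_apply, mul_one]
    -- The power δ is set aside as the potential, while the power r absorbs the cutoff and becomes
    -- linear in ω^r by Jensen.
    calc cutoff ρ y₀ x ^ (((n : ℝ) - a) * r) * extension n a w x ^ (r + δ)
        = (cutoff ρ y₀ x ^ ((n : ℝ) - a) * extension n a w x) ^ r * extension n a w x ^ δ := by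
          rw [ENNReal.mul_rpow_of_nonneg _ _ (by linarith), ← ENNReal.rpow_mul,
            ENNReal.rpow_add_of_nonneg _ _ (by linarith) hδ.le, mul_assoc]
      _ ≤ (2 ^ ((n : ℝ) - a) * extension n a ω x + C) ^ r * extension n a w x ^ δ := by gcongr
      _ ≤ (2 ^ (r - 1) * (2 ^ ((n : ℝ) - a)) ^ r * extension n a ω x ^ r + 2 ^ (r - 1) * C ^ r) *
          extension n a w x ^ δ := by
          gcongr
          exact rpow_mul_add_le hr.le _ _ _
      _ ≤ (2 ^ (r - 1) * (2 ^ ((n : ℝ) - a)) ^ r * extension n a (fun y => ω y ^ r) x +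
          2 ^ (r - 1) * C ^ r) * extension n a w x ^ δ := by
          gcongr
          exact extension_rpow_le hn ha hω hr hx
      _ = _ := by ring
  · rw [cutoff_eq_zero_iff.2 (not_lt.1 h), ENNReal.zero_rpow_of_pos (by positivity), zero_mul]
    exact zero_le


/-! ### Higher integrability and local boundedness. -/

/-- Higher integrability near `y₀` of a solution of `w ^ r ≤ B (P^*((P w)^{r + δ}) + 1)`. -/
theorem exists_lintegral_cutoff_mul_rpow_ne_top {n : ℕ} (hn : 2 ≤ n) {a : ℝ} (ha : a < 1)
    {r δ : ℝ} (hr : 1 < r) (hδ : 0 < δ) (hrδ : (n : ℝ) * δ = (r + 1) * (1 + 1 / ((n : ℝ) - 1)))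
    {w : Bdry n → ℝ≥0∞} (hw : Measurable w) (y₀ : Bdry n)
    {z : Bdry n × ℝ} (hz : 0 < z.2) (hz' : extension n a w z ≠ ⊤) {z₀ : Bdry n}
    (hz₀ : coextension n a (fun x => extension n a w x ^ (r + δ)) z₀ ≠ ⊤)
    (hLp : ∫⁻ y in Metric.ball y₀ 2, w y ^ (r + 1) ≠ ⊤) {B : ℝ≥0∞} (hB : B ≠ ⊤)
    (hineq : ∀ᵐ y, y ∈ Metric.ball y₀ 1 →
      w y ^ r ≤ B * (coextension n a (fun x => extension n a w x ^ (r + δ)) y + 1))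
    {t : ℝ} (ht : 1 < t) :
    ∃ ρ : ℝ, 0 < ρ ∧ ρ ≤ 1 ∧
      ∫⁻ y, (cutoff ρ y₀ (y, 0) ^ ((n : ℝ) - a) * w y) ^ (r * t) ≠ ⊤ := by
  have hn' : (2 : ℝ) ≤ n := by exact_mod_cast hn
  have hθ : 0 < (n : ℝ) - a := by linarith
  have hr0 : 0 < r := by linarith
  set θ := (n : ℝ) - a with hθdef
  set U := extension n a w with hU
  have hUm : Measurable U := measurable_extension n a hw
  -- The space in which W = ω^r starts: W^s = ω^{r+1}.
  set s := (r + 1) / r with hs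
  have hs1 : 1 < s := by rw [hs, one_lt_div hr0]; linarith
  obtain ⟨C₁, hC₁, hb₁⟩ := exists_lintegral_coextension_mul_extension_le hn ha hs1
  obtain ⟨C₂, hC₂, hb₂⟩ := exists_lintegral_coextension_mul_extension_le hn ha ht
  set A : ℝ≥0∞ := 2 ^ (r - 1) * (2 ^ θ) ^ r with hA
  have hAtop : A ≠ ⊤ := ENNReal.mul_ne_top
    (ENNReal.rpow_ne_top_of_nonneg (by linarith) (by simp))
    (ENNReal.rpow_ne_top_of_nonneg hr0.le (ENNReal.rpow_ne_top_of_nonneg hθ.le (by simp)))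
  have h2m : (2 : ℝ≥0∞) ^ (θ * r) ≠ ⊤ := ENNReal.rpow_ne_top_of_nonneg (by positivity) (by simp)
  set c : ℝ≥0∞ := B * (2 ^ (θ * r) * A) with hc
  have hctop : c ≠ ⊤ := ENNReal.mul_ne_top hB (ENNReal.mul_ne_top h2m hAtop)
  -- the choice of the radius
  have hlocal := setLIntegral_extension_rpow_ne_top hn ha y₀ hw hz hz' (t := r + 1) (by linarith) hLp
  -- The sum C₁ + C₂ lets one radius serve for the contractions on both L^s and L^t. The radius
  -- therefore depends on t.
  obtain ⟨k, hk⟩ : ∃ k : ℕ, c * (C₁ + C₂) * (∫⁻ x in {x | rad y₀ x < 1 / ((k : ℝ) + 1)},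
      U x ^ ((n : ℝ) * δ) ∂(volume.restrict (halfSpace n))) ^ (1 / (n : ℝ)) ≤ 2⁻¹ := by
    rw [← hrδ] at hlocal
    have h1 := ((ENNReal.continuous_rpow_const (y := 1 / (n : ℝ))).tendsto 0).comp
      (tendsto_setLIntegral_rad_lt y₀ hlocal)
    rw [ENNReal.zero_rpow_of_pos (by positivity)] at h1
    have h2 := ENNReal.Tendsto.const_mul (a := c * (C₁ + C₂)) h1
      (Or.inr (ENNReal.mul_ne_top hctop (ENNReal.add_ne_top.2 ⟨hC₁, hC₂⟩)))
    rw [mul_zero] at h2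
    exact (h2.eventually_le_const (u := 2⁻¹) (by simp)).exists
  set ρ := 1 / ((k : ℝ) + 1) with hρ
  have hρ0 : 0 < ρ := by positivity
  have hρ1 : ρ ≤ 1 := by
    rw [hρ, div_le_one (by positivity)]; linarith [(Nat.cast_nonneg k : (0 : ℝ) ≤ k)]
  refine ⟨ρ, hρ0, hρ1, ?_⟩
  have hD := measurableSet_rad_lt y₀ ρ
  set D := {x : Bdry n × ℝ | rad y₀ x < ρ} with hDdef
  set V : Bdry n × ℝ → ℝ≥0∞ := D.indicator (fun x => U x ^ δ) with hV
  have hVm : Measurable V := Measurable.indicator (by fun_prop) hD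
  set N := (∫⁻ x in halfSpace n, V x ^ (n : ℝ)) ^ (1 / (n : ℝ)) with hN
  have hNeq : ∫⁻ x in halfSpace n, V x ^ (n : ℝ) =
      ∫⁻ x in D, U x ^ ((n : ℝ) * δ) ∂(volume.restrict (halfSpace n)) := by
    rw [← lintegral_indicator hD]
    refine lintegral_congr fun x => ?_
    by_cases hx : x ∈ D
    · simp only [hV, Set.indicator_of_mem hx, ← ENNReal.rpow_mul, mul_comm]
    · have : (0 : ℝ) < n := by linarith
      simp only [hV, Set.indicator_of_notMem hx, ENNReal.zero_rpow_of_pos this]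
  rw [← hNeq, ← hN] at hk
  have hk1 : c * (C₁ * N) ≤ 2⁻¹ := le_trans (by
    rw [← mul_assoc]; gcongr; exact le_self_add) hk
  have hk2 : c * (C₂ * N) ≤ 2⁻¹ := le_trans (by
    rw [← mul_assoc]; gcongr; exact le_add_self) hk
  set ω : Bdry n → ℝ≥0∞ := fun y => cutoff ρ y₀ (y, 0) ^ θ * w y with hω
  have hωm : Measurable ω := by fun_prop
  obtain ⟨C₃, hC₃, hcut⟩ := exists_cutoff_mul_extension_le hn ha ρ y₀ hw hz hz'
  obtain ⟨C₄, hC₄, hcut'⟩ := exists_cutoff_mul_coextension_le hn ha ρ y₀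
    (g := fun x => U x ^ (r + δ)) (by fun_prop) hz₀ (m := θ * r) (by nlinarith)
  set A' : ℝ≥0∞ := 2 ^ (r - 1) * C₃ ^ r with hA'
  have hA'top : A' ≠ ⊤ := ENNReal.mul_ne_top
    (ENNReal.rpow_ne_top_of_nonneg (by linarith) (by simp))
    (ENNReal.rpow_ne_top_of_nonneg hr0.le hC₃)
  set W : Bdry n → ℝ≥0∞ := fun y => ω y ^ r with hW
  have hWm : Measurable W := by fun_prop
  set c' : ℝ≥0∞ := B * (2 ^ (θ * r) * A') with hc'
  have hc'top : c' ≠ ⊤ := ENNReal.mul_ne_top hB (ENNReal.mul_ne_top h2m hA'top)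
  set h₁ : Bdry n → ℝ≥0∞ := coextension n a (fun x => V x * D.indicator 1 x) with hh₁
  have hVDm : Measurable (fun x => V x * D.indicator 1 x) := hVm.mul (measurable_one.indicator hD)
  have hh₁m : Measurable h₁ := measurable_coextension n a hVDm
  -- The inhomogeneity collects the errors of both cutoff moves. The first term is in L^t because V
  -- is in L^n and the indicator of a bounded half-ball is in every L^q; the second is bounded with
  -- bounded support.
  set h : Bdry n → ℝ≥0∞ := fun y =>
    c' * h₁ y + (Metric.ball y₀ 1).indicator (fun _ => B * (C₄ + 1)) y with hh
  have hhm : Measurable h :=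
    (hh₁m.const_mul c').add (measurable_const.indicator measurableSet_ball)
  let T : (Bdry n → ℝ≥0∞) → Bdry n → ℝ≥0∞ := fun f y =>
    c * coextension n a (fun x => V x * extension n a f x) y
  have hTnorm : ∀ {q : ℝ} {C : ℝ≥0∞}, 0 < q → c * (C * N) ≤ 2⁻¹ →
      ∀ f : Bdry n → ℝ≥0∞, (∫⁻ y, coextension n a (fun x => V x * extension n a f x) y ^ q ≤
        (C * N) ^ q * ∫⁻ y, f y ^ q) →
      ∫⁻ y, T f y ^ q ≤ 2⁻¹ ^ q * ∫⁻ y, f y ^ q := by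
    intro q C hq hCN f hf
    have hcq : c ^ q ≠ ⊤ := ENNReal.rpow_ne_top_of_nonneg hq.le hctop
    simp only [T, ENNReal.mul_rpow_of_nonneg _ _ hq.le]
    rw [lintegral_const_mul' _ _ hcq]
    calc _ ≤ c ^ q * ((C * N) ^ q * ∫⁻ y, f y ^ q) := by gcongr
      _ = (c * (C * N)) ^ q * ∫⁻ y, f y ^ q := by
        rw [ENNReal.mul_rpow_of_nonneg c _ hq.le]; ring
      _ ≤ _ := by gcongr
  have hmain := lintegral_rpow_ne_top_of_le_contraction (μ := (volume : Measure (Bdry n))) T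
    (fun f hf => (measurable_coextension n a
      (hVm.mul (measurable_extension n a hf))).const_mul c)
    (fun f g hfg y => by
      refine mul_le_mul' le_rfl (coextension_mono (fun x _ => ?_) y)
      exact mul_le_mul' le_rfl (extension_mono hfg x))
    (fun f g hf y => by
      have e1 : (fun x => V x * extension n a (f + g) x) =
          (fun x => V x * extension n a f x) + fun x => V x * extension n a g x := by
        ext x
        simp only [Pi.add_apply, extension_add hf, mul_add]
      simp only [T, e1]
      rw [coextension_add (g := fun x => V x * extension n a f x)
        (hVm.mul (measurable_extension n a hf)), mul_add])
    hs1.le ht.le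
    (fun f hf => hTnorm (by linarith) hk1 f (hb₁ V f hVm hf))
    (fun f hf => hTnorm (by linarith) hk2 f (hb₂ V f hVm hf))
    (W := W) (h := h) hWm hhm ?_ ?_ ?_
  · refine ne_of_eq_of_ne (lintegral_congr fun y => ?_) hmain
    rw [hW, ENNReal.rpow_mul]
  · have e1 : ∀ y, W y ^ s = ω y ^ (r + 1) := fun y => by
      rw [hW, ← ENNReal.rpow_mul, hs, mul_div_cancel₀ _ hr0.ne']
    simp only [e1]
    refine lintegral_cutoff_mul_rpow_ne_top hθ (by linarith) y₀ (ne_top_of_le_ne_top hLp ?_)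
    exact lintegral_mono_set (Metric.ball_subset_ball (by linarith))
  · have hnorm : ∫⁻ y, h₁ y ^ t ≠ ⊤ := by
      obtain ⟨C₅, hC₅, hb₅⟩ := exists_lintegral_coextension_rpow_le hn ha ht
      refine ne_top_of_le_ne_top ?_ (hb₅ V (D.indicator 1) hVm (measurable_one.indicator hD))
      have hNtop : N ≠ ⊤ := by
        refine ENNReal.rpow_ne_top_of_nonneg (by positivity) ?_
        rw [hNeq, hrδ]
        refine ne_top_of_le_ne_top hlocal (lintegral_mono_set fun x hx => ?_)
        exact lt_of_lt_of_le (show rad y₀ x < ρ from hx) hρ1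
      have hd : 0 < (n : ℝ) - 1 := by linarith
      have hq0 : 0 < t * (1 + 1 / ((n : ℝ) - 1)) := by positivity
      refine ENNReal.rpow_ne_top_of_nonneg (by linarith) (ENNReal.mul_ne_top
        (ENNReal.mul_ne_top hC₅ hNtop) (ENNReal.rpow_ne_top_of_nonneg (by positivity) ?_))
      have e2 : ∀ x, D.indicator (1 : Bdry n × ℝ → ℝ≥0∞) x ^ (t * (1 + 1 / ((n : ℝ) - 1))) =
          D.indicator 1 x := by
        intro x
        by_cases hx : x ∈ D
        · simp [hx]
        · simp only [Set.indicator_of_notMem hx, ENNReal.zero_rpow_of_pos hq0]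
      simp only [e2]
      rw [lintegral_indicator_one hD]
      exact ne_top_of_le_ne_top (volume_rad_lt_ne_top y₀ hρ1) (Measure.restrict_apply_le _ _)
    have ht0 : 0 < t := by linarith
    have h2t : (2 : ℝ≥0∞) ^ (t - 1) ≠ ⊤ := ENNReal.rpow_ne_top_of_nonneg (by linarith) (by simp)
    refine ne_top_of_le_ne_top ?_ (lintegral_mono fun y =>
      ENNReal.rpow_add_le_mul_rpow_add_rpow _ _ ht.le)
    rw [lintegral_const_mul' _ _ h2t]
    refine ENNReal.mul_ne_top h2t ?_
    rw [lintegral_add_left (by fun_prop)]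
    refine ENNReal.add_ne_top.2 ⟨?_, ?_⟩
    · simp only [ENNReal.mul_rpow_of_nonneg _ _ ht0.le]
      have hc't : c' ^ t ≠ ⊤ := ENNReal.rpow_ne_top_of_nonneg ht0.le hc'top
      rw [lintegral_const_mul' _ _ hc't]
      exact ENNReal.mul_ne_top hc't hnorm
    · have e3 : ∀ y, (Metric.ball y₀ 1).indicator (fun _ => B * (C₄ + 1)) y ^ t =
          (Metric.ball y₀ 1).indicator (fun _ => (B * (C₄ + 1)) ^ t) y := by
        intro y
        by_cases hy : y ∈ Metric.ball y₀ 1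
        · simp only [Set.indicator_of_mem hy]
        · simp only [Set.indicator_of_notMem hy, ENNReal.zero_rpow_of_pos ht0]
      simp only [e3]
      rw [lintegral_indicator_const measurableSet_ball]
      exact ENNReal.mul_ne_top (ENNReal.rpow_ne_top_of_nonneg ht0.le
        (ENNReal.mul_ne_top hB (ENNReal.add_ne_top.2 ⟨hC₄, by simp⟩))) measure_ball_lt_top.ne
  -- Multiply the inequality by the cutoff to the power θr, move it inside P*, and linearize there.
  -- Outside the ball of radius ρ, W vanishes.
  · filter_upwards [hineq] with y hy
    by_cases hyρ : ‖y - y₀‖ < ρ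
    · have hyb : y ∈ Metric.ball y₀ 1 := by
        rw [Metric.mem_ball, dist_eq_norm]; exact hyρ.trans_le hρ1
      have hcut1 : cutoff ρ y₀ (y, 0) ^ (θ * r) ≤ 1 := by
        refine ENNReal.rpow_le_one ((cutoff_le _ _ _).trans ?_) (by positivity)
        rwa [ENNReal.ofReal_le_one]
      have hco : coextension n a (fun x => cutoff ρ y₀ x ^ (θ * r) * U x ^ (r + δ)) y ≤
          A * coextension n a (fun x => V x * extension n a W x) y + A' * h₁ y := by
        have hVW : Measurable (fun x => V x * extension n a W x) :=
          hVm.mul (measurable_extension n a hWm)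
        rw [← coextension_const_mul hVW, hh₁, ← coextension_const_mul hVDm,
          ← coextension_add (hVW.const_mul A)]
        refine coextension_mono (fun x hx => ?_) y
        exact cutoff_rpow_mul_rpow_le hn ha hr hδ hωm hx (hcut x hx)
      calc W y = cutoff ρ y₀ (y, 0) ^ (θ * r) * w y ^ r := by
            simp only [hW, hω]
            rw [ENNReal.mul_rpow_of_nonneg _ _ hr0.le, ← ENNReal.rpow_mul]
        _ ≤ cutoff ρ y₀ (y, 0) ^ (θ * r) *
            (B * (coextension n a (fun x => U x ^ (r + δ)) y + 1)) := by gcongr; exact hy hyb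
        _ = B * (cutoff ρ y₀ (y, 0) ^ (θ * r) * coextension n a (fun x => U x ^ (r + δ)) y +
            cutoff ρ y₀ (y, 0) ^ (θ * r)) := by ring
        _ ≤ B * ((2 ^ (θ * r) * (A * coextension n a (fun x => V x * extension n a W x) y +
            A' * h₁ y) + C₄) + 1) := by
            gcongr
            refine (hcut' y).trans ?_
            gcongr
        _ = T W y + h y := by
            simp only [T, hh, Set.indicator_of_mem hyb, hc, hc']
            ring
    · have h0 : cutoff ρ y₀ (y, 0) = 0 := by
        rw [cutoff_eq_zero_iff, rad_zero]; exact not_lt.1 hyρ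
      have : W y = 0 := by
        simp only [hW, hω, h0, ENNReal.zero_rpow_of_pos hθ, zero_mul, ENNReal.zero_rpow_of_pos hr0]
      rw [this]
      exact zero_le

/-- Local boundedness of the nonlinear term. -/
theorem exists_ball_coextension_le {n : ℕ} (hn : 2 ≤ n) {a : ℝ} (ha : a < 1)
    {r δ : ℝ} (hr : 1 < r) (hδ : 0 < δ) (hrδ : (n : ℝ) * δ = (r + 1) * (1 + 1 / ((n : ℝ) - 1)))
    {w : Bdry n → ℝ≥0∞} (hw : Measurable w) (y₀ : Bdry n)
    {z : Bdry n × ℝ} (hz : 0 < z.2) (hz' : extension n a w z ≠ ⊤) {z₀ : Bdry n}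
    (hz₀ : coextension n a (fun x => extension n a w x ^ (r + δ)) z₀ ≠ ⊤)
    (hLp : ∫⁻ y in Metric.ball y₀ 2, w y ^ (r + 1) ≠ ⊤) {B : ℝ≥0∞} (hB : B ≠ ⊤)
    (hineq : ∀ᵐ y, y ∈ Metric.ball y₀ 1 →
      w y ^ r ≤ B * (coextension n a (fun x => extension n a w x ^ (r + δ)) y + 1)) :
    ∃ ρ : ℝ, 0 < ρ ∧ ∃ M : ℝ≥0∞, M ≠ ⊤ ∧ ∀ y ∈ Metric.ball y₀ ρ,
      coextension n a (fun x => extension n a w x ^ (r + δ)) y ≤ M := by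
  have hn' : (2 : ℝ) ≤ n := by exact_mod_cast hn
  have hd : 0 < (n : ℝ) - 1 := by linarith
  have hθ : 0 < (n : ℝ) - a := by linarith
  have hr0 : 0 < r := by linarith
  set κ := r + δ with hκ
  have hκ1 : 1 < κ := by linarith
  set e := 1 / ((n : ℝ) - 1) with he
  have he0 : 0 < e := by positivity
  have hne : (n : ℝ) = (1 + e) * (n - 1) := by rw [he]; field_simp; ring
  -- Chosen so that rt · n/(n-1) = 2nκ: then the κ-th power of the extension of ω is in L^{2n}.
  set t := 2 * ((n : ℝ) - 1) * κ / r with ht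
  have hrt : r * t = 2 * ((n : ℝ) - 1) * κ := by rw [ht]; field_simp
  have ht1 : 1 < t := by
    rw [ht, one_lt_div hr0]
    nlinarith
  have hrt1 : 1 < r * t := by nlinarith
  obtain ⟨ρ, hρ0, hρ1, hfin⟩ := exists_lintegral_cutoff_mul_rpow_ne_top hn ha hr hδ hrδ hw y₀ hz
    hz' hz₀ hLp hB hineq ht1
  set θ := (n : ℝ) - a with hθdef
  set U := extension n a w with hU
  have hUm : Measurable U := measurable_extension n a hw
  set ω : Bdry n → ℝ≥0∞ := fun y => cutoff ρ y₀ (y, 0) ^ θ * w y with hω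
  have hωm : Measurable ω := by fun_prop
  obtain ⟨C₃, hC₃, hcut⟩ := exists_cutoff_mul_extension_le hn ha ρ y₀ hw hz hz'
  have hθκ : 0 < θ * κ := by positivity
  obtain ⟨C₄, hC₄, hcut'⟩ := exists_cutoff_mul_coextension_le hn ha ρ y₀
    (g := fun x => U x ^ κ) (by fun_prop) hz₀ (m := θ * κ) (by nlinarith)
  obtain ⟨C₁, hC₁, hstrong⟩ := exists_lintegral_extension_rpow_le hn ha hrt1
  have hD := measurableSet_rad_lt y₀ ρ
  set D := {x : Bdry n × ℝ | rad y₀ x < ρ} with hDdef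
  have hωext := measurable_extension n a hωm
  set g : Bdry n × ℝ → ℝ≥0∞ := D.indicator (fun x => (2 ^ θ * extension n a ω x + C₃) ^ κ) with hg
  have hgm : Measurable g := Measurable.indicator (by fun_prop) hD
  have h2θ : (2 : ℝ≥0∞) ^ θ ≠ ⊤ := ENNReal.rpow_ne_top_of_nonneg hθ.le (by simp)
  have hgfin : ∫⁻ x in halfSpace n, g x ^ (2 * (n : ℝ)) ≠ ⊤ := by
    have e1 : ∀ x, g x ^ (2 * (n : ℝ)) =
        D.indicator (fun x => (2 ^ θ * extension n a ω x + C₃) ^ (κ * (2 * n))) x := by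
      intro x
      by_cases hx : x ∈ D
      · simp only [hg, Set.indicator_of_mem hx, ENNReal.rpow_mul]
      · simp only [hg, Set.indicator_of_notMem hx]
        exact ENNReal.zero_rpow_of_pos (by positivity)
    simp only [e1]
    rw [lintegral_indicator hD]
    refine lintegral_mul_add_rpow_ne_top (restrict_rad_lt_univ_ne_top y₀ hρ1) (by nlinarith) ?_
      h2θ hC₃
    refine ne_top_of_le_ne_top ?_ (setLIntegral_le_lintegral _ _)
    refine ne_top_of_le_ne_top (ENNReal.mul_ne_top hC₁
      (ENNReal.rpow_ne_top_of_nonneg (by positivity) hfin))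
      (le_trans (le_of_eq ?_) (hstrong ω hωm))
    have : κ * (2 * n) = r * t * (1 + e) := by
      rw [hrt]; nth_rewrite 1 [hne]; ring
    rw [this]
  obtain ⟨C₅, hC₅, hco⟩ := exists_coextension_le_of_lintegral_rpow hn ha hgm hρ0.le
    (fun x hx => Set.indicator_of_notMem (fun h : x ∈ D =>
      absurd (hx.trans (height_le_rad y₀ x)) (not_le.2 h)) _) hgfin
  have hbound : ∀ y, cutoff ρ y₀ (y, 0) ^ (θ * κ) * coextension n a (fun x => U x ^ κ) y ≤
      2 ^ (θ * κ) * C₅ + C₄ := by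
    intro y
    refine (hcut' y).trans ?_
    gcongr
    refine le_trans (coextension_mono (fun x hx => ?_) y) (hco y)
    by_cases hxD : x ∈ D
    · simp only [hg, Set.indicator_of_mem hxD]
      rw [ENNReal.rpow_mul, ← ENNReal.mul_rpow_of_nonneg _ _ (by linarith)]
      gcongr
      exact hcut x hx
    · rw [cutoff_eq_zero_iff.2 (not_lt.1 hxD), ENNReal.zero_rpow_of_pos hθκ, zero_mul]
      exact zero_le
  -- On the half-size ball the cutoff is at least ρ/2 and can be divided out.
  refine ⟨ρ / 2, by positivity, (2 ^ (θ * κ) * C₅ + C₄) / ENNReal.ofReal (ρ / 2) ^ (θ * κ), ?_,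
    fun y hy => ?_⟩
  · refine ENNReal.div_ne_top (ENNReal.add_ne_top.2 ⟨ENNReal.mul_ne_top
      (ENNReal.rpow_ne_top_of_nonneg hθκ.le (by simp)) hC₅, hC₄⟩) ?_
    simp [ENNReal.rpow_eq_zero_iff, hρ0]
  · have hle : ENNReal.ofReal (ρ / 2) ≤ cutoff ρ y₀ (y, 0) := by
      rw [Metric.mem_ball, dist_eq_norm] at hy
      refine ENNReal.ofReal_le_ofReal ?_
      rw [rad_zero]
      linarith
    rw [ENNReal.le_div_iff_mul_le (Or.inl (by simp [ENNReal.rpow_eq_zero_iff, hρ0]))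
      (Or.inl (ENNReal.rpow_ne_top_of_nonneg hθκ.le ENNReal.ofReal_ne_top)), mul_comm]
    refine le_trans ?_ (hbound y)
    gcongr


/-! ### Hölder estimate for the adjoint operator. -/

/-- Only the case where y is nearer to x than z needs work. The kernels then differ by the factor
q^{n-a}, with q ≤ 1 the ratio of distances; Bernoulli (n-a ≥ 1) gives 1 - q^{n-a} ≤ (n-a)(1-q), and
1 - q ≤ (1-q)^β ≤ (|y-z| / |x-(y,0)|)^β. -/
theorem kernel_le_kernel_add {n : ℕ} (hn : 2 ≤ n) {a : ℝ} (ha : a < 1) {β : ℝ} (hβ : 0 < β)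
    (hβ1 : β < 1) (y z : Bdry n) {x : Bdry n × ℝ} (hx : 0 < x.2) :
    kernel n a y x ≤ kernel n a z x +
      ((n : ℝ) - a) * ‖y - z‖ ^ β * (kernel n a y x * rad y x ^ (-β)) := by
  have hn' : (2 : ℝ) ≤ n := by exact_mod_cast hn
  have hθ : 1 ≤ (n : ℝ) - a := by linarith
  have hc := normConst_pos n (by omega) a ha
  have hy := rad_pos y hx
  have hz := rad_pos z hx
  have hky := kernel_pos hn ha y hx
  have hkz := kernel_pos hn ha z hx
  rcases le_total (rad z x) (rad y x) with h | h
  · have h1 : kernel n a y x ≤ kernel n a z x := by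
      rw [kernel_eq, kernel_eq]
      gcongr
    have h2 : 0 ≤ ((n : ℝ) - a) * ‖y - z‖ ^ β * (kernel n a y x * rad y x ^ (-β)) := by positivity
    linarith
  · set q := rad y x / rad z x with hq
    have hq0 : 0 < q := by positivity
    have hq1 : q ≤ 1 := (div_le_one hz).2 h
    have e1 : kernel n a z x = kernel n a y x * q ^ ((n : ℝ) - a) := by
      rw [kernel_eq, kernel_eq, hq, Real.div_rpow hy.le hz.le]
      field_simp
    have e2 : 1 - q ^ ((n : ℝ) - a) ≤ ((n : ℝ) - a) * (1 - q) := by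
      have := one_add_mul_self_le_rpow_one_add (s := q - 1) (by linarith) hθ
      rw [add_sub_cancel] at this
      linarith
    have e3 : 1 - q ≤ ‖y - z‖ ^ β * rad y x ^ (-β) := by
      have h3 : 1 - q ≤ ‖y - z‖ / rad z x := by
        rw [hq, one_sub_div hz.ne']
        gcongr
        have := rad_le_add z y x
        rw [rad_zero] at this
        linarith
      calc 1 - q = (1 - q) ^ (1 : ℝ) := (Real.rpow_one _).symm
        _ ≤ (1 - q) ^ β := Real.rpow_le_rpow_of_exponent_ge' (by linarith) (by linarith) hβ.le hβ1.le
        _ ≤ (‖y - z‖ / rad z x) ^ β := Real.rpow_le_rpow (by linarith) h3 hβ.le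
        _ ≤ (‖y - z‖ / rad y x) ^ β := by gcongr
        _ = _ := by rw [Real.div_rpow (norm_nonneg _) hy.le, Real.rpow_neg hy.le, div_eq_mul_inv]
    have e4 : 1 - q ^ ((n : ℝ) - a) ≤ ((n : ℝ) - a) * (‖y - z‖ ^ β * rad y x ^ (-β)) :=
      e2.trans (by gcongr)
    rw [e1]
    nlinarith [mul_le_mul_of_nonneg_left e4 hky.le]

/-- Hölder estimate for `coextension` where the density is locally bounded. -/
theorem coextension_le_coextension_add {n : ℕ} (hn : 2 ≤ n) {a : ℝ} (ha : a < 1) {β : ℝ}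
    (hβ : 0 < β) (hβ1 : β < 1) {G : Bdry n × ℝ → ℝ≥0∞} (hG : Measurable G) {M : ℝ≥0∞}
    {y : Bdry n} (hM : ∀ x : Bdry n × ℝ, 0 < x.2 → rad y x < 1 → G x ≤ M) (z : Bdry n) :
    coextension n a G y ≤ coextension n a G z + ENNReal.ofReal (((n : ℝ) - a) * ‖y - z‖ ^ β) *
      (M * ENNReal.ofReal (1 / (1 - β)) + coextension n a G y) := by
  have hn' : (2 : ℝ) ≤ n := by exact_mod_cast hn
  have hθ : 0 ≤ (n : ℝ) - a := by linarith
  set D := ENNReal.ofReal (((n : ℝ) - a) * ‖y - z‖ ^ β)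
  set S := {x : Bdry n × ℝ | x.2 < 1}
  have hS : MeasurableSet S := measurableSet_lt measurable_snd measurable_const
  set k : Bdry n × ℝ → ℝ≥0∞ :=
    S.indicator (fun x => ekernel n a y x * ENNReal.ofReal (x.2 ^ (-β))) with hk
  have hkm : Measurable k := Measurable.indicator (by fun_prop) hS
  have hpt : ∀ x ∈ halfSpace n, ekernel n a y x * G x ≤
      ekernel n a z x * G x + D * (M * k x + ekernel n a y x * G x) := by
    intro x hx
    have hx : 0 < x.2 := hx
    have hky := kernel_pos hn ha y hx
    have hkz := kernel_pos hn ha z hx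
    have hy := rad_pos y hx
    have h1 : ekernel n a y x ≤
        ekernel n a z x + D * (ekernel n a y x * ENNReal.ofReal (rad y x ^ (-β))) := by
      rw [← ENNReal.ofReal_mul hky.le, ← ENNReal.ofReal_mul (by positivity),
        ← ENNReal.ofReal_add hkz.le (by positivity)]
      exact ENNReal.ofReal_le_ofReal (kernel_le_kernel_add hn ha hβ hβ1 y z hx)
    -- Within distance one of y, G is bounded and the singular factor is at most x_n^{-β}; farther
    -- away that factor is at most one and the integral of the kernel against G itself suffices.
    have h2 : ekernel n a y x * ENNReal.ofReal (rad y x ^ (-β)) * G x ≤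
        M * k x + ekernel n a y x * G x := by
      by_cases hr : rad y x < 1
      · have hxS : x ∈ S := (height_le_rad y x).trans_lt hr
        refine le_trans ?_ le_self_add
        rw [hk, Set.indicator_of_mem hxS, mul_comm M]
        gcongr ?_ * ENNReal.ofReal ?_ * ?_
        · exact le_rfl
        · exact Real.rpow_le_rpow_of_nonpos hx (height_le_rad y x) (by linarith)
        · exact hM x hx hr
      · refine le_trans ?_ le_add_self
        have : ENNReal.ofReal (rad y x ^ (-β)) ≤ 1 := by
          rw [ENNReal.ofReal_le_one]
          exact Real.rpow_le_one_of_one_le_of_nonpos (not_lt.1 hr) (by linarith)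
        calc _ ≤ ekernel n a y x * 1 * G x := by gcongr
          _ = _ := by rw [mul_one]
    calc ekernel n a y x * G x
        ≤ (ekernel n a z x + D * (ekernel n a y x * ENNReal.ofReal (rad y x ^ (-β)))) * G x := by
          gcongr
      _ = ekernel n a z x * G x +
          D * (ekernel n a y x * ENNReal.ofReal (rad y x ^ (-β)) * G x) := by ring
      _ ≤ _ := by gcongr
  calc coextension n a G y
      ≤ ∫⁻ x in halfSpace n, (ekernel n a z x * G x + D * (M * k x + ekernel n a y x * G x)) :=
        setLIntegral_mono' (measurableSet_halfSpace n) hpt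
    _ = coextension n a G z + D * (M * (∫⁻ x in halfSpace n, k x) + coextension n a G y) := by
        rw [lintegral_add_left (by fun_prop), lintegral_const_mul _ (by fun_prop),
          lintegral_add_left (by fun_prop), lintegral_const_mul _ hkm]
        rfl
    _ ≤ _ := by
        gcongr
        have := lintegral_ekernel_mul_height_le hn ha hβ1 zero_le_one y
        rwa [Real.one_rpow] at this

/-- The extension of a locally bounded function is locally bounded. -/
theorem exists_extension_le_of_locally_bounded {n : ℕ} (hn : 2 ≤ n) {a : ℝ} (ha : a < 1)
    (y₀ : Bdry n) {R : ℝ} {w : Bdry n → ℝ≥0∞} (hw : Measurable w) {z : Bdry n × ℝ}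
    (hz : 0 < z.2) (hfin : extension n a w z ≠ ⊤) {M : ℝ≥0∞} (hM : M ≠ ⊤)
    (hbd : ∀ᵐ y, y ∈ Metric.ball y₀ (R + 1) → w y ≤ M) :
    ∃ C : ℝ≥0∞, C ≠ ⊤ ∧ ∀ x : Bdry n × ℝ, 0 < x.2 → rad y₀ x < R → extension n a w x ≤ C := by
  have hn' : (2 : ℝ) ≤ n := by exact_mod_cast hn
  have hθ : 0 < (n : ℝ) - a := by linarith
  obtain ⟨C, hC, hcut⟩ := exists_cutoff_mul_extension_le hn ha (R + 1) y₀ hw hz hfin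
  set A := ENNReal.ofReal (R + 1) ^ ((n : ℝ) - a) * M with hA
  refine ⟨2 ^ ((n : ℝ) - a) * A + C, ?_, fun x hx hxR => ?_⟩
  · refine ENNReal.add_ne_top.2 ⟨ENNReal.mul_ne_top
      (ENNReal.rpow_ne_top_of_nonneg hθ.le (by simp)) (ENNReal.mul_ne_top
        (ENNReal.rpow_ne_top_of_nonneg hθ.le ENNReal.ofReal_ne_top) hM), hC⟩
  have hcut1 : 1 ≤ cutoff (R + 1) y₀ x := by
    rw [cutoff, ENNReal.one_le_ofReal]
    linarith
  calc extension n a w x = 1 ^ ((n : ℝ) - a) * extension n a w x := by simp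
    _ ≤ cutoff (R + 1) y₀ x ^ ((n : ℝ) - a) * extension n a w x := by gcongr
    _ ≤ _ := hcut x hx
    _ ≤ _ := by
      gcongr
      refine extension_le_const hn ha (hbd.mono fun y hy => ?_) hx
      by_cases hyb : y ∈ Metric.ball y₀ (R + 1)
      · rw [hA]
        gcongr
        · exact cutoff_le _ _ _
        · exact hy hyb
      · have h0 : cutoff (R + 1) y₀ (y, 0) = 0 := by
          rw [cutoff_eq_zero_iff, rad_zero]
          simpa [dist_eq_norm] using hyb
        rw [h0, ENNReal.zero_rpow_of_pos hθ, zero_mul]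
        exact zero_le

/-! ### Positivity, finiteness and operations on Hölder functions. -/

theorem extension_ne_zero {n : ℕ} (hn : 2 ≤ n) {a : ℝ} (ha : a < 1) {w : Bdry n → ℝ≥0∞}
    (hw : Measurable w) (h : ¬ w =ᵐ[volume] 0) {x : Bdry n × ℝ} (hx : 0 < x.2) :
    extension n a w x ≠ 0 := by
  intro h0
  refine h (((lintegral_eq_zero_iff (by fun_prop)).1 h0).mono fun y hy => ?_)
  rcases mul_eq_zero.1 (show ekernel n a y x * w y = 0 from hy) with h1 | h1
  · exact absurd h1 (by simpa using kernel_pos hn ha y hx)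
  · exact h1

theorem volume_halfSpace_ne_zero (n : ℕ) : volume (halfSpace n) ≠ 0 := by
  have ho : IsOpen (halfSpace n) := isOpen_lt continuous_const continuous_snd
  exact (ho.measure_pos volume ⟨(0, 1), show (0 : ℝ) < 1 from one_pos⟩).ne'

theorem coextension_ne_zero {n : ℕ} (hn : 2 ≤ n) {a : ℝ} (ha : a < 1) {G : Bdry n × ℝ → ℝ≥0∞}
    (hG : Measurable G) (h : ∀ x : Bdry n × ℝ, 0 < x.2 → G x ≠ 0) (y : Bdry n) :
    coextension n a G y ≠ 0 := by
  intro h0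
  have h1 := (ae_restrict_iff' (measurableSet_halfSpace n)).1
    ((lintegral_eq_zero_iff (by fun_prop)).1 h0)
  refine volume_halfSpace_ne_zero n (measure_mono_null (fun x hx => ?_) (ae_iff.1 h1))
  rw [Set.mem_ofPred_eq]
  intro hcon
  have hx : 0 < x.2 := hx
  rcases mul_eq_zero.1 (show ekernel n a y x * G x = 0 from hcon hx) with h2 | h2
  · exact absurd h2 (by simpa using kernel_pos hn ha y hx)
  · exact h x hx h2

/-- The kernel is positive, so an infinite density throughout would give an infinite integral. The
point found serves as reference point when a cutoff is moved through the extension. -/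
theorem exists_ne_top_of_coextension_ne_top {n : ℕ} (hn : 2 ≤ n) {a : ℝ} (ha : a < 1)
    {G : Bdry n × ℝ → ℝ≥0∞} (hG : Measurable G) {y : Bdry n} (h : coextension n a G y ≠ ⊤) :
    ∃ x : Bdry n × ℝ, 0 < x.2 ∧ G x ≠ ⊤ := by
  by_contra! hcon
  have h1 := (ae_restrict_iff' (measurableSet_halfSpace n)).1 (ae_lt_top (by fun_prop) h)
  refine volume_halfSpace_ne_zero n (measure_mono_null (fun x hx => ?_) (ae_iff.1 h1))
  rw [Set.mem_ofPred_eq]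
  intro hlt
  have hx' : 0 < x.2 := hx
  have h2 := hlt hx
  rw [hcon x hx', ENNReal.mul_top (by simpa using kernel_pos hn ha y hx')] at h2
  exact lt_irrefl _ h2

/-- Quotients and powers of positive functions with a Hölder modulus. -/
theorem exists_abs_div_rpow_sub_le {m₁ M₁ m₂ M₂ : ℝ} (hm₁ : 0 < m₁) (hm₂ : 0 < m₂) (γ : ℝ) :
    ∃ L : ℝ≥0, ∀ s ∈ Set.Icc m₁ M₁, ∀ s' ∈ Set.Icc m₁ M₁, ∀ t ∈ Set.Icc m₂ M₂,
      ∀ t' ∈ Set.Icc m₂ M₂, |(s / t) ^ γ - (s' / t') ^ γ| ≤ L * max |s - s'| |t - t'| := by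
  have hC : ContDiffOn ℝ 1 (fun q : ℝ × ℝ => (q.1 / q.2) ^ γ)
      (Set.Icc m₁ M₁ ×ˢ Set.Icc m₂ M₂) := by
    intro q hq
    have h1 : 0 < q.1 := hm₁.trans_le hq.1.1
    have h2 : 0 < q.2 := hm₂.trans_le hq.2.1
    exact ((contDiffAt_fst.div contDiffAt_snd h2.ne').rpow_const_of_ne
      (div_pos h1 h2).ne').contDiffWithinAt
  obtain ⟨L, hL⟩ := hC.exists_lipschitzOnWith one_ne_zero
    ((convex_Icc _ _).prod (convex_Icc _ _)) (isCompact_Icc.prod isCompact_Icc)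
  refine ⟨L, fun s hs s' hs' t ht t' ht' => ?_⟩
  have := hL.dist_le_mul (s, t) ⟨hs, ht⟩ (s', t') ⟨hs', ht'⟩
  simpa [Real.dist_eq, Prod.dist_eq] using this


theorem holderOnWith_of_abs_sub_le {n : ℕ} {β : ℝ≥0} {C : ℝ} (hC : 0 ≤ C)
    {v : Bdry n → ℝ} {s : Set (Bdry n)}
    (h : ∀ x ∈ s, ∀ y ∈ s, |v x - v y| ≤ C * ‖x - y‖ ^ (β : ℝ)) :
    HolderOnWith C.toNNReal β v s := by
  intro x hx y hy
  rw [edist_dist, edist_dist, ENNReal.ofReal_rpow_of_nonneg dist_nonneg β.coe_nonneg, Real.dist_eq,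
    dist_eq_norm]
  change _ ≤ ENNReal.ofReal C * _
  rw [← ENNReal.ofReal_mul hC]
  exact ENNReal.ofReal_le_ofReal (h x hx y hy)

theorem locallyHolder_of_closedBall {n : ℕ} {β : ℝ≥0} {v : Bdry n → ℝ}
    (h : ∀ R : ℝ, 0 ≤ R → ∃ C : ℝ, 0 ≤ C ∧ ∀ x ∈ Metric.closedBall 0 R,
      ∀ y ∈ Metric.closedBall 0 R, |v x - v y| ≤ C * ‖x - y‖ ^ (β : ℝ)) :
    LocallyHolder n β v := by
  intro s hs
  obtain ⟨R, hR⟩ := hs.isBounded.subset_closedBall 0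
  obtain ⟨C, hC, hv⟩ := h (max R 0) (le_max_right _ _)
  exact ⟨C.toNNReal, (holderOnWith_of_abs_sub_le hC hv).mono
    (hR.trans (Metric.closedBall_subset_closedBall (le_max_left _ _)))⟩

/-- On a ball F and K range in compact intervals of (0, ∞), where (s, t) ↦ (s/t)^γ is Lipschitz for
every real γ. K is Lipschitz there, hence β-Hölder because the ball has diameter at most 2R. -/
theorem LocallyHolder.div_rpow {n : ℕ} {β : ℝ≥0} (hβ : 0 < β) (hβ1 : β < 1) {F K : Bdry n → ℝ}
    (hF : LocallyHolder n β F) (hFpos : ∀ y, 0 < F y) (hK : ContDiff ℝ 1 K)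
    (hKpos : ∀ y, 0 < K y) (γ : ℝ) : LocallyHolder n β (fun y => (F y / K y) ^ γ) := by
  refine locallyHolder_of_closedBall fun R hR => ?_
  have hcomp : IsCompact (Metric.closedBall (0 : Bdry n) R) := isCompact_closedBall _ _
  have hne : (Metric.closedBall (0 : Bdry n) R).Nonempty := ⟨0, by simpa using hR⟩
  obtain ⟨C, hC⟩ := hF _ hcomp
  have hFc := hC.continuousOn hβ
  obtain ⟨y₁, -, h₁⟩ := hcomp.exists_isMinOn hne hFc
  obtain ⟨y₂, -, h₂⟩ := hcomp.exists_isMaxOn hne hFc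
  obtain ⟨y₃, -, h₃⟩ := hcomp.exists_isMinOn hne hK.continuous.continuousOn
  obtain ⟨y₄, -, h₄⟩ := hcomp.exists_isMaxOn hne hK.continuous.continuousOn
  obtain ⟨L, hL⟩ := hK.contDiffOn.exists_lipschitzOnWith one_ne_zero
    (convex_closedBall (0 : Bdry n) R) hcomp
  obtain ⟨A, hA⟩ := exists_abs_div_rpow_sub_le (M₁ := F y₂) (M₂ := K y₄) (hFpos y₁) (hKpos y₃) γ
  refine ⟨A * (C + L * (2 * R) ^ (1 - (β : ℝ))), by positivity, fun x hx y hy => ?_⟩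
  have hFx : |F x - F y| ≤ C * ‖x - y‖ ^ (β : ℝ) := by
    have := hC.dist_le hx hy
    rwa [Real.dist_eq, dist_eq_norm] at this
  have hKx : |K x - K y| ≤ L * (2 * R) ^ (1 - (β : ℝ)) * ‖x - y‖ ^ (β : ℝ) := by
    have h := hL.dist_le_mul x hx y hy
    rw [Real.dist_eq, dist_eq_norm] at h
    have hβ' : (β : ℝ) ≤ 1 := by exact_mod_cast hβ1.le
    have hxy : ‖x - y‖ ≤ 2 * R := by
      rw [mem_closedBall_zero_iff] at hx hy
      linarith [norm_sub_le x y]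
    calc |K x - K y| ≤ L * ‖x - y‖ := h
      _ = L * (‖x - y‖ ^ (1 - (β : ℝ)) * ‖x - y‖ ^ (β : ℝ)) := by
        rw [← Real.rpow_add_of_nonneg (norm_nonneg _) (by linarith) β.coe_nonneg, sub_add_cancel,
          Real.rpow_one]
      _ ≤ L * ((2 * R) ^ (1 - (β : ℝ)) * ‖x - y‖ ^ (β : ℝ)) := by
        have := Real.rpow_le_rpow (norm_nonneg _) hxy (sub_nonneg.2 hβ')
        gcongr
      _ = _ := by ring
  calc _ ≤ A * max |F x - F y| |K x - K y| :=
        hA _ ⟨h₁ hx, h₂ hx⟩ _ ⟨h₁ hy, h₂ hy⟩ _ ⟨h₃ hx, h₄ hx⟩ _ ⟨h₃ hy, h₄ hy⟩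
    _ ≤ A * (|F x - F y| + |K x - K y|) := by
        gcongr
        exact max_le_add_of_nonneg (abs_nonneg _) (abs_nonneg _)
    _ ≤ A * (C * ‖x - y‖ ^ (β : ℝ) + L * (2 * R) ^ (1 - (β : ℝ)) * ‖x - y‖ ^ (β : ℝ)) := by
        gcongr
    _ = _ := by ring

/-- Hölder regularity of `coextension` of a locally bounded density. -/
theorem locallyHolder_coextension {n : ℕ} (hn : 2 ≤ n) {a : ℝ} (ha : a < 1) {β : ℝ≥0}
    (hβ : 0 < β) (hβ1 : β < 1) {G : Bdry n × ℝ → ℝ≥0∞} (hG : Measurable G)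
    (hGbd : ∀ R : ℝ, ∃ M : ℝ≥0∞, M ≠ ⊤ ∧ ∀ x : Bdry n × ℝ, 0 < x.2 → rad 0 x < R → G x ≤ M)
    (hbd : ∀ R : ℝ, ∃ M : ℝ≥0∞, M ≠ ⊤ ∧ ∀ y ∈ Metric.closedBall 0 R, coextension n a G y ≤ M) :
    LocallyHolder n β (fun y => (coextension n a G y).toReal) := by
  have hn' : (2 : ℝ) ≤ n := by exact_mod_cast hn
  have hθ : 0 ≤ (n : ℝ) - a := by linarith
  refine locallyHolder_of_closedBall fun R hR => ?_
  obtain ⟨M₁, hM₁, hG₁⟩ := hGbd (R + 1)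
  obtain ⟨M₂, hM₂, hf₂⟩ := hbd R
  set D := M₁ * ENNReal.ofReal (1 / (1 - (β : ℝ))) + M₂ with hD
  have hDtop : D ≠ ⊤ := ENNReal.add_ne_top.2 ⟨ENNReal.mul_ne_top hM₁ ENNReal.ofReal_ne_top, hM₂⟩
  have hfin : ∀ y ∈ Metric.closedBall 0 R, coextension n a G y ≠ ⊤ := fun y hy =>
    ne_top_of_le_ne_top hM₂ (hf₂ y hy)
  -- The one-sided estimate is enough: exchanging y and z gives the absolute value.
  have key : ∀ y ∈ Metric.closedBall 0 R, ∀ z ∈ Metric.closedBall 0 R,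
      (coextension n a G y).toReal - (coextension n a G z).toReal ≤
        ((n : ℝ) - a) * D.toReal * ‖y - z‖ ^ (β : ℝ) := by
    intro y hy z hz
    have h1 := coextension_le_coextension_add hn ha (β := (β : ℝ)) (by exact_mod_cast hβ)
      (by exact_mod_cast hβ1) hG (M := M₁) (y := y) (fun x hx hr => hG₁ x hx (by
        rw [mem_closedBall_zero_iff] at hy
        have := rad_le_add 0 y x
        rw [rad_zero, sub_zero] at this
        linarith)) z
    have h2 : coextension n a G y ≤ coextension n a G z +
        ENNReal.ofReal (((n : ℝ) - a) * ‖y - z‖ ^ (β : ℝ)) * D := by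
      refine h1.trans ?_
      rw [hD]
      gcongr
      exact hf₂ y hy
    have hprod : ENNReal.ofReal (((n : ℝ) - a) * ‖y - z‖ ^ (β : ℝ)) * D ≠ ⊤ :=
      ENNReal.mul_ne_top ENNReal.ofReal_ne_top hDtop
    have h3 := ENNReal.toReal_mono (ENNReal.add_ne_top.2 ⟨hfin z hz, hprod⟩) h2
    rw [ENNReal.toReal_add (hfin z hz) hprod, ENNReal.toReal_mul,
      ENNReal.toReal_ofReal (by positivity)] at h3
    linarith
  refine ⟨((n : ℝ) - a) * D.toReal, by positivity, fun y hy z hz => abs_sub_le_iff.2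
    ⟨key y hy z hz, ?_⟩⟩
  rw [norm_sub_rev]
  exact key z hz y hy

/-! ### From the equation to the integral inequality, and the conclusion. -/

theorem setLIntegral_ball_ofReal_rpow_ne_top {n : ℕ} {p q : ℝ} (hq : 0 < q) (hqp : q ≤ p)
    {u : Bdry n → ℝ} (hu : MemLpLoc n p u) (y₀ : Bdry n) (R : ℝ) :
    ∫⁻ y in Metric.ball y₀ R, ENNReal.ofReal (u y) ^ q ≠ ⊤ := by
  have hcomp := isCompact_closedBall y₀ R
  have : IsFiniteMeasure (volume.restrict (Metric.closedBall y₀ R)) :=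
    ⟨by rw [Measure.restrict_apply_univ]; exact hcomp.measure_lt_top⟩
  have h1 : MemLp u (ENNReal.ofReal q) (volume.restrict (Metric.closedBall y₀ R)) :=
    (hu.2 _ hcomp).mono_exponent (ENNReal.ofReal_le_ofReal hqp)
  have h2 := lintegral_rpow_enorm_lt_top_of_eLpNorm_lt_top (by simpa using hq)
    ENNReal.ofReal_ne_top h1.2
  rw [ENNReal.toReal_ofReal hq.le] at h2
  refine ne_top_of_le_ne_top h2.ne ((lintegral_mono fun y => ?_).trans
    (lintegral_mono_set Metric.ball_subset_closedBall))
  dsimp only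
  gcongr
  rw [Real.enorm_eq_ofReal_abs]
  exact ENNReal.ofReal_le_ofReal (le_abs_self _)

theorem EquationAt.ofReal_mul_rpow {n : ℕ} {a p : ℝ} {K u : Bdry n → ℝ} {y : Bdry n}
    (h : EquationAt n a p K u y) (hp : 0 ≤ p - 1) (hK : 0 < K y) (hu : 0 ≤ u y) :
    ENNReal.ofReal (u y) ^ (p - 1) = nonlinearTerm n a u y / ENNReal.ofReal (K y) := by
  rw [← h, ENNReal.ofReal_mul hK.le, ← ENNReal.ofReal_rpow_of_nonneg hu hp, mul_comm,
    ENNReal.mul_div_cancel_right (by simpa using hK) ENNReal.ofReal_ne_top]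

theorem exists_pos_le_on_closedBall {n : ℕ} {K : Bdry n → ℝ} (hK : Continuous K)
    (hKpos : ∀ y, 0 < K y) (y₀ : Bdry n) (R : ℝ) :
    ∃ k : ℝ, 0 < k ∧ ∀ y ∈ Metric.closedBall y₀ R, k ≤ K y := by
  rcases (Metric.closedBall y₀ R).eq_empty_or_nonempty with he | hne
  · exact ⟨1, one_pos, by simp [he]⟩
  · obtain ⟨y₁, -, h₁⟩ := (isCompact_closedBall y₀ R).exists_isMinOn hne hK.continuousOn
    exact ⟨K y₁, hKpos y₁, fun y hy => h₁ hy⟩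

end PoissonType

open PoissonType

theorem theorem2p3 (n : ℕ) (hn : 2 ≤ n) (a : ℝ) (ha : 2 - (n : ℝ) < a) (ha1 : a < 1)
    (p : ℝ) (hp : 2 * ((n : ℝ) - 1) / ((n : ℝ) + a - 2) ≤ p)
    (K : Bdry n → ℝ) (hK : ContDiff ℝ 1 K) (hKpos : ∀ y, 0 < K y)
    (u : Bdry n → ℝ) (hu : MemLpLoc n p u)
    (hu0 : ∀ᵐ y, 0 ≤ u y) (hune : ¬ u =ᵐ[volume] 0)
    (heq : ∀ᵐ y, EquationAt n a p K u y) :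
    ∃ v : Bdry n → ℝ, v =ᵐ[volume] u ∧
      (∀ y, 0 ≤ u y → EquationAt n a p K u y → v y = u y) ∧
      ∀ β : ℝ≥0, 0 < β → β < 1 → LocallyHolder n β v := by
  have hn' : (2 : ℝ) ≤ n := by exact_mod_cast hn
  have hb : 0 < (n : ℝ) + a - 2 := by linarith
  have hd : 0 < (n : ℝ) - 1 := by linarith
  set r := ((n : ℝ) - a) / ((n : ℝ) + a - 2) with hr
  set δ := 2 / ((n : ℝ) + a - 2) with hδ
  have hr1 : 1 < r := by rw [hr, one_lt_div hb]; linarith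
  have hδ0 : 0 < δ := by positivity
  have hκ : ((n : ℝ) - a + 2) / ((n : ℝ) + a - 2) = r + δ := by rw [hr, hδ, ← add_div]
  have hrδ : (n : ℝ) * δ = (r + 1) * (1 + 1 / ((n : ℝ) - 1)) := by
    rw [hr, hδ]; field_simp; ring
  have hrp : r + 1 ≤ p := by
    refine le_trans (le_of_eq ?_) hp
    rw [hr]; field_simp; ring
  have hp1 : 0 < p - 1 := by linarith
  -- a measurable representative
  set w : Bdry n → ℝ≥0∞ := fun y => ENNReal.ofReal (hu.1.mk u y) with hw
  have hwm : Measurable w := hu.1.stronglyMeasurable_mk.measurable.ennreal_ofReal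
  have hwu : ∀ᵐ y, ENNReal.ofReal (u y) = w y := hu.1.ae_eq_mk.mono fun y hy => by simp only [hw, hy]
  have hU : poissonIntegral n a u = extension n a w := extension_congr hwu
  have hUm : Measurable (extension n a w) := measurable_extension n a hwm
  have hGm : Measurable (fun x => extension n a w x ^ (r + δ)) := by fun_prop
  -- An identity at every point, since the extension sees only the almost-everywhere class of u.
  have hf : nonlinearTerm n a u = coextension n a (fun x => extension n a w x ^ (r + δ)) := by
    ext y
    simp only [nonlinearTerm, coextension, hU, hκ]
  have hweq : ∀ᵐ y, w y ^ (p - 1) =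
      coextension n a (fun x => extension n a w x ^ (r + δ)) y / ENNReal.ofReal (K y) := by
    filter_upwards [hu0, heq, hwu] with y h1 h2 h3
    rw [← h3, h2.ofReal_mul_rpow hp1.le (hKpos y) h1, hf]
  have hwne : ¬ w =ᵐ[volume] 0 := by
    intro h
    refine hune ?_
    filter_upwards [h, hu0, hwu] with y h1 h2 h3
    rw [h1] at h3
    exact le_antisymm (ENNReal.ofReal_eq_zero.1 h3) h2
  -- One point where the equation holds, with its finite left side, supplies both reference points
  -- for the cutoff estimates.
  obtain ⟨z₀, hz₀⟩ := heq.exists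
  have hz₀' : coextension n a (fun x => extension n a w x ^ (r + δ)) z₀ ≠ ⊤ := by
    rw [← hf, ← hz₀]; exact ENNReal.ofReal_ne_top
  obtain ⟨z, hz, hz'⟩ := exists_ne_top_of_coextension_ne_top hn ha1 hGm hz₀'
  have hUz : extension n a w z ≠ ⊤ := fun h => hz' (by
    rw [h, ENNReal.top_rpow_of_pos (by linarith)])
  -- local boundedness of the nonlinear term
  have hlocal : ∀ y₀ : Bdry n, ∃ ρ : ℝ, 0 < ρ ∧ ∃ M : ℝ≥0∞, M ≠ ⊤ ∧ ∀ y ∈ Metric.ball y₀ ρ,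
      coextension n a (fun x => extension n a w x ^ (r + δ)) y ≤ M := by
    intro y₀
    obtain ⟨k, hk, hkK⟩ := exists_pos_le_on_closedBall hK.continuous hKpos y₀ 1
    refine exists_ball_coextension_le hn ha1 hr1 hδ0 hrδ hwm y₀ hz hUz hz₀' ?_
      (B := 1 + (ENNReal.ofReal k)⁻¹) ?_ ?_
    · refine ne_of_eq_of_ne (setLIntegral_congr_fun_ae measurableSet_ball ?_)
        (setLIntegral_ball_ofReal_rpow_ne_top (by linarith) hrp hu y₀ 2)
      exact hwu.mono fun y hy _ => by rw [hy]
    · exact ENNReal.add_ne_top.2 ⟨by simp, ENNReal.inv_ne_top.2 (by simpa using hk)⟩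
    · filter_upwards [hweq] with y hy hyb
      set f := coextension n a (fun x => extension n a w x ^ (r + δ)) y
      -- The lower bound on p enters here as r ≤ p - 1, reducing every admissible p to the critical
      -- exponent.
      have h1 : w y ^ r ≤ 1 + w y ^ (p - 1) := by
        rcases le_total (w y) 1 with h | h
        · exact (ENNReal.rpow_le_one h (by linarith)).trans le_self_add
        · exact (ENNReal.rpow_le_rpow_of_exponent_le h (by linarith)).trans le_add_self
      calc w y ^ r ≤ 1 + f / ENNReal.ofReal (K y) := by rw [← hy]; exact h1
        _ ≤ 1 + f / ENNReal.ofReal k := by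
          gcongr
          exact hkK y (Metric.ball_subset_closedBall hyb)
        _ ≤ 1 + f / ENNReal.ofReal k + (f + (ENNReal.ofReal k)⁻¹) := le_self_add
        _ = (1 + (ENNReal.ofReal k)⁻¹) * (f + 1) := by rw [div_eq_mul_inv]; ring
  have hbd : ∀ R : ℝ, ∃ M : ℝ≥0∞, M ≠ ⊤ ∧ ∀ y ∈ Metric.closedBall 0 R,
      coextension n a (fun x => extension n a w x ^ (r + δ)) y ≤ M := by
    intro R
    refine (isCompact_closedBall (0 : Bdry n) R).induction_on
      (p := fun s => ∃ M : ℝ≥0∞, M ≠ ⊤ ∧ ∀ y ∈ s,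
        coextension n a (fun x => extension n a w x ^ (r + δ)) y ≤ M) ?_ ?_ ?_ ?_
    · exact ⟨0, by simp, by simp⟩
    · rintro s t hst ⟨M, hM, h⟩
      exact ⟨M, hM, fun y hy => h y (hst hy)⟩
    · rintro s t ⟨M, hM, h⟩ ⟨M', hM', h'⟩
      refine ⟨M + M', ENNReal.add_ne_top.2 ⟨hM, hM'⟩, fun y hy => ?_⟩
      rcases hy with hy | hy
      · exact (h y hy).trans le_self_add
      · exact (h' y hy).trans le_add_self
    · intro y₀ _
      obtain ⟨ρ, hρ, M, hM, h⟩ := hlocal y₀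
      exact ⟨Metric.ball y₀ ρ, mem_nhdsWithin_of_mem_nhds (Metric.ball_mem_nhds y₀ hρ), M, hM, h⟩
  have hGbd : ∀ R : ℝ, ∃ M : ℝ≥0∞, M ≠ ⊤ ∧ ∀ x : Bdry n × ℝ, 0 < x.2 → rad 0 x < R →
      extension n a w x ^ (r + δ) ≤ M := by
    intro R
    obtain ⟨M, hM, h⟩ := hbd (R + 1)
    obtain ⟨k, hk, hkK⟩ := exists_pos_le_on_closedBall hK.continuous hKpos 0 (R + 1)
    -- The equation turns the bound M on the nonlinear term into the bound (M/k)^{1/(p-1)} on w over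
    -- a slightly larger ball.
    obtain ⟨C, hC, hUC⟩ := exists_extension_le_of_locally_bounded hn ha1 0 (R := R) hwm hz hUz
      (M := (M / ENNReal.ofReal k) ^ (1 / (p - 1))) (ENNReal.rpow_ne_top_of_nonneg (by positivity)
        (ENNReal.div_ne_top hM (by simpa using hk))) (by
        filter_upwards [hweq] with y hy hyb
        have hyb' := Metric.ball_subset_closedBall hyb
        rw [one_div, ENNReal.le_rpow_inv_iff hp1, hy]
        gcongr
        · exact h y hyb'
        · exact hkK y hyb')
    refine ⟨C ^ (r + δ), ENNReal.rpow_ne_top_of_nonneg (by linarith) hC, fun x hx hxR => ?_⟩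
    gcongr
    exact hUC x hx hxR
  set F : Bdry n → ℝ := fun y => (nonlinearTerm n a u y).toReal with hF
  -- Strict positivity matters because 1/(p-1) < 1, so the root is not Lipschitz at zero.
  have hFpos : ∀ y, 0 < F y := by
    intro y
    obtain ⟨M, hM, h⟩ := hbd ‖y‖
    refine ENNReal.toReal_pos ?_ ?_
    · rw [hf]
      refine coextension_ne_zero hn ha1 hGm (fun x hx => ?_) y
      have := extension_ne_zero hn ha1 hwm hwne hx
      simp only [ne_eq, ENNReal.rpow_eq_zero_iff, not_or, not_and_or]
      exact ⟨Or.inl this, Or.inr (by linarith)⟩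
    · rw [hf]
      exact ne_top_of_le_ne_top hM (h y (by simp))
  -- F is built from u itself and is defined everywhere, so solving the equation for u works
  -- pointwise and not only almost everywhere.
  have hveq : ∀ y, 0 ≤ u y → EquationAt n a p K u y → (F y / K y) ^ (1 / (p - 1)) = u y := by
    intro y hy h
    have h1 : F y = K y * u y ^ (p - 1) := by
      rw [hF]
      dsimp only
      rw [← h, ENNReal.toReal_ofReal (mul_nonneg (hKpos y).le (Real.rpow_nonneg hy _))]
    rw [h1, mul_div_cancel_left₀ _ (hKpos y).ne', ← Real.rpow_mul hy, mul_one_div_cancel hp1.ne',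
      Real.rpow_one]
  refine ⟨fun y => (F y / K y) ^ (1 / (p - 1)), ?_, hveq, fun β hβ hβ1 => ?_⟩
  · filter_upwards [hu0, heq] with y h1 h2 using hveq y h1 h2
  · refine LocallyHolder.div_rpow hβ hβ1 ?_ hFpos hK hKpos _
    rw [hF, hf]
    exact locallyHolder_coextension hn ha1 hβ hβ1 hGm hGbd hbd
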